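/- **Theorem 2.2 (Weighted energy dissipation).** Let $\alpha\in(0,1)$, $T>0$, $N\ge1$, $\Delta t=T/N$, $t_n=n\Delta t$, $\gamma>0$, $\varepsilon>0$, and let $\Omega=\prod_{i=1}^d[0,\ell_i]$ ($d\ge 1$, $\ell_i>0$) with periodic boundary conditions. Put $$b_j=\frac{\Delta t^{1-\alpha}}{\Gamma(2-\alpha)}\big[(j+1)^{1-\alpha}-j^{1-\alpha}\big],\qquad \bar\partial_k u=\frac{u^k-u^{k-1}}{\Delta t},\qquad \bar\partial^\alpha_n u=\sum_{j=1}^n b_{n-j}\,\bar\partial_j u .$$ Consider the stabilized L1 scheme $$\bar\partial^\alpha_{n+1}\phi=\gamma\,\mathcal G\big(\mathcal L\phi^{n+1}+\delta_\phi E_1(\phi^n)+\widetilde{\mathcal L}(\phi^{n+1}-\phi^n)\big),\qquad 0\le n\le N-1,$$ for one of the following time-fractional phase-field models. * Allen–Cahn: $\mathcal G=-1$, $\mathcal L=-\varepsilon^2\Delta$, $\delta_\phi E_1(\phi)=F'(\phi)$ with $F(\phi)=\frac14(1-\phi^2)^2$, $\widetilde{\mathcal L}=S$ with $S\ge2$,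 $E(\phi)=\int_\Omega\big(\frac{\varepsilon^2}2|\nabla\phi|^2+F(\phi)\big)\,dx$, and initial data with $\|\phi^0\|_\infty\le1$. * Cahn–Hilliard: $\mathcal G=\Delta$, $\mathcal L=-\varepsilon^2\Delta$, $\delta_\phi E_1(\phi)=F'(\phi)$ with a (truncated double-well) potential $F\in C^2(\mathbb R)$ such that $|F''|\le L$ for a constant $L>0$, $\widetilde{\mathcal L}=S$ with $S\ge L/2$, and $E(\phi)=\int_\Omega\big(\frac{\varepsilon^2}2|\nabla\phi|^2+F(\phi)\big)\,dx$. * MBE without slope selection: $\mathcal G=-1$, $\mathcal L=\varepsilon^2\Delta^2$, $\delta_\phi E_1(\phi)=\nabla\cdot\frac{\nabla\phi}{1+|\nabla\phi|^2}$, $\widetilde{\mathcal L}=-S\Delta$ with $S\ge\frac1{16}$, and $E(\phi)=\int_\Omega\big(\frac{\varepsilon^2}2|\Delta\phi|^2-\frac12\ln(1+|\nabla\phi|^2)\big)\,dx$. Let $\phi^0,\dots,\phi^N$ be $\Omega$-periodic functions that solve the scheme pointwise in the classical sense: $\phi^0\in C^1$ and $\phi^{n+1}\in C^2$ for Allen–Cahn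 and Cahn–Hilliard, where for Cahn–Hilliard also the argument of $\mathcal G$ in the scheme is $C^2$; $\phi^0\in C^2$ and $\phi^{n+1}\in C^4$ for MBE ($0\le n\le N-1$). Write $E^n=E(\phi^n)$ and $$\widetilde E^n=E^0+\Delta t\sum_{m=1}^nD^m,\qquad D^m=\frac1{\Gamma(\alpha)\,t_m}\sum_{k=1}^m t_k^\alpha\, b_{m-k}\,\bar\partial_kE .$$ Then, for all $1\le n\le N$, $$\widetilde E^n\le\widetilde E^{n-1},$$ equivalently $D^n\le0$. -/

import Mathlib

open scoped Laplacian

noncomputable section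

namespace TimeFractionalPhaseField

/-! ### The L1 discretization of the Caputo derivative -/

/-- The L1 coefficients `b_j = τ^(1-α) / Γ(2-α) * ((j+1)^(1-α) - j^(1-α))`. -/
def l1Coeff (α τ : ℝ) (j : ℕ) : ℝ :=
  τ ^ (1 - α) / Real.Gamma (2 - α) * (((j : ℝ) + 1) ^ (1 - α) - (j : ℝ) ^ (1 - α))

/-- The backward difference quotient `(u^k - u^(k-1)) / τ`, used for `k ≥ 1`. -/
def backwardDiff (τ : ℝ) (u : ℕ → ℝ) (k : ℕ) : ℝ :=
  (u k - u (k - 1)) / τ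

/-- The L1 fractional derivative `∑_{j=1}^n b_{n-j} (u^j - u^(j-1)) / τ`. -/
def l1Deriv (α τ : ℝ) (u : ℕ → ℝ) (n : ℕ) : ℝ :=
  ∑ j ∈ Finset.Icc 1 n, l1Coeff α τ (n - j) * backwardDiff τ u j

/-! ### Differential operators on periodic functions of `d` variables -/

/-- One closed periodicity cell `∏ᵢ [0, ℓᵢ]`. -/
def cell {d : ℕ} (ℓ : Fin d → ℝ) : Set (EuclideanSpace ℝ (Fin d)) :=
  {x | ∀ i, x i ∈ Set.Icc 0 (ℓ i)}

/-- `u` has period `ℓᵢ` in the `i`-th coordinate, for every `i`. -/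
def IsPeriodic {d : ℕ} (ℓ : Fin d → ℝ) (u : EuclideanSpace ℝ (Fin d) → ℝ) : Prop :=
  ∀ i, Function.Periodic u (EuclideanSpace.single i (ℓ i))

/-- The divergence `∑ᵢ ∂ᵢ vᵢ` of a vector field. -/
def divergence {d : ℕ} (v : EuclideanSpace ℝ (Fin d) → EuclideanSpace ℝ (Fin d))
    (x : EuclideanSpace ℝ (Fin d)) : ℝ :=
  ∑ i, (fderiv ℝ v x (EuclideanSpace.single i 1)) i

/-! ### The phase-field models -/

/-- The three models. For the Cahn-Hilliard model the (truncated) double-well potential `F` and the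
bound `L` for `|F''|` are parameters. -/
inductive Model where
  | allenCahn : Model
  | cahnHilliard (F : ℝ → ℝ) (L : ℝ) : Model
  | mbeNoSlopeSelection : Model

/-- The double-well potential `(1 - u²)² / 4`. -/
def doubleWell (u : ℝ) : ℝ := (1 - u ^ 2) ^ 2 / 4

/-- The vector field `f_m(p) = p / (1 + |p|²)`. -/
def mbeFlux {d : ℕ} (p : EuclideanSpace ℝ (Fin d)) : EuclideanSpace ℝ (Fin d) :=
  (1 / (1 + ‖p‖ ^ 2)) • p

namespace Model

variable {d : ℕ}

/-- The nonpositive operator `𝒢`: `-1` or the Laplacian. -/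
def opG : Model → (EuclideanSpace ℝ (Fin d) → ℝ) → EuclideanSpace ℝ (Fin d) → ℝ
  | allenCahn, μ => fun x => -μ x
  | cahnHilliard _ _, μ => Δ μ
  | mbeNoSlopeSelection, μ => fun x => -μ x

/-- The linear operator `ℒ` of the quadratic part of the energy: `-ε²Δ` or `ε²Δ²`. -/
def opL (ε : ℝ) : Model → (EuclideanSpace ℝ (Fin d) → ℝ) → EuclideanSpace ℝ (Fin d) → ℝ
  | allenCahn, u => fun x => -(ε ^ 2 * Δ u x)
  | cahnHilliard _ _, u => fun x => -(ε ^ 2 * Δ u x)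
  | mbeNoSlopeSelection, u => fun x => ε ^ 2 * Δ (Δ u) x

/-- The first variation `δE₁/δu` of the nonquadratic part of the energy: `F'(u)` or `∇·f_m(∇u)`. -/
def varE1 : Model → (EuclideanSpace ℝ (Fin d) → ℝ) → EuclideanSpace ℝ (Fin d) → ℝ
  | allenCahn, u => fun x => deriv doubleWell (u x)
  | cahnHilliard F _, u => fun x => deriv F (u x)
  | mbeNoSlopeSelection, u => divergence fun x => mbeFlux (gradient u x)

/-- The stabilization operator: `S` or `-SΔ`. -/
def opStab (S : ℝ) : Model → (EuclideanSpace ℝ (Fin d) → ℝ) → EuclideanSpace ℝ (Fin d) → ℝ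
  | allenCahn, u => fun x => S * u x
  | cahnHilliard _ _, u => fun x => S * u x
  | mbeNoSlopeSelection, u => fun x => -(S * Δ u x)

/-- The classical energy, an integral over one periodicity cell. -/
def energy (ε : ℝ) (ℓ : Fin d → ℝ) : Model → (EuclideanSpace ℝ (Fin d) → ℝ) → ℝ
  | allenCahn, u =>
      ∫ x in cell ℓ, (ε ^ 2 / 2 * ‖gradient u x‖ ^ 2 + doubleWell (u x))
  | cahnHilliard F _, u =>
      ∫ x in cell ℓ, (ε ^ 2 / 2 * ‖gradient u x‖ ^ 2 + F (u x))
  | mbeNoSlopeSelection, u =>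
      ∫ x in cell ℓ, (ε ^ 2 / 2 * (Δ u x) ^ 2 - 1 / 2 * Real.log (1 + ‖gradient u x‖ ^ 2))

/-- The conditions on the potential and on the stabilization constant `S`. -/
def Admissible (S : ℝ) : Model → Prop
  | allenCahn => 2 ≤ S
  | cahnHilliard F L => ContDiff ℝ 2 F ∧ 0 < L ∧ (∀ s, |deriv (deriv F) s| ≤ L) ∧ L / 2 ≤ S
  | mbeNoSlopeSelection => 1 / 16 ≤ S

/-- The stabilized semi-implicit chemical potential
`ℒ v + (δE₁/δu)(u) + ℒ̃ (v - u)`, with `u` the old and `v` the new time level. -/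
def chemPot (M : Model) (ε S : ℝ) (u v : EuclideanSpace ℝ (Fin d) → ℝ) :
    EuclideanSpace ℝ (Fin d) → ℝ :=
  fun x => M.opL ε v x + M.varE1 u x + M.opStab S (fun y => v y - u y) x

/-- Classical regularity of the time levels `0, …, N`: every derivative that occurs in the energy or
in the scheme exists in the classical sense and is continuous. -/
def Regular (M : Model) (ε S : ℝ) (N : ℕ) (φ : ℕ → EuclideanSpace ℝ (Fin d) → ℝ) : Prop :=
  match M with
  | allenCahn => ContDiff ℝ 1 (φ 0) ∧ ∀ n < N, ContDiff ℝ 2 (φ (n + 1))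
  | cahnHilliard F L => ContDiff ℝ 1 (φ 0) ∧ ∀ n < N, ContDiff ℝ 2 (φ (n + 1)) ∧
      ContDiff ℝ 2 ((cahnHilliard F L).chemPot ε S (φ n) (φ (n + 1)))
  | mbeNoSlopeSelection => ContDiff ℝ 2 (φ 0) ∧ ∀ n < N, ContDiff ℝ 4 (φ (n + 1))

/-- `φ⁰, …, φᴺ` is a periodic classical solution of the stabilized L1 scheme with time step `τ`. -/
structure IsL1Solution (M : Model) (α τ γ ε S : ℝ) (ℓ : Fin d → ℝ) (N : ℕ)
    (φ : ℕ → EuclideanSpace ℝ (Fin d) → ℝ) : Prop where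
  periodic : ∀ n ≤ N, IsPeriodic ℓ (φ n)
  regular : M.Regular ε S N φ
  scheme : ∀ n < N, ∀ x,
    l1Deriv α τ (fun k => φ k x) (n + 1) = γ * M.opG (M.chemPot ε S (φ n) (φ (n + 1))) x

end Model

/-! ### The discrete weighted energy of a sequence of energies -/

/-- `D^m = 1 / (Γ(α) t_m) * ∑_{k=1}^m t_k^α b_{m-k} (E^k - E^(k-1)) / τ`, where `t_k = k τ`. -/
def weightedDeriv (α τ : ℝ) (E : ℕ → ℝ) (m : ℕ) : ℝ :=
  1 / (Real.Gamma α * ((m : ℝ) * τ)) *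
    ∑ k ∈ Finset.Icc 1 m, ((k : ℝ) * τ) ^ α * l1Coeff α τ (m - k) * backwardDiff τ E k

/-- `Ẽ^n = E⁰ + τ ∑_{m=1}^n D^m`. -/
def weightedEnergy (α τ : ℝ) (E : ℕ → ℝ) (n : ℕ) : ℝ :=
  E 0 + τ * ∑ m ∈ Finset.Icc 1 n, weightedDeriv α τ E m

end TimeFractionalPhaseField

end

open scoped Laplacian

noncomputable section

namespace TimeFractionalPhaseField

/-! ### A discrete positivity criterion for triangular kernels -/

/-! Write μᵏ for the chemical potential of step k and vᵏ = (φᵏ − φᵏ⁻¹)/τ. Each model satisfies a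
one-step estimate Eᵏ − Eᵏ⁻¹ ≤ ∫ μᵏ (φᵏ − φᵏ⁻¹): the implicit quadratic part is convex, and
stabilization absorbs the second-order Taylor remainder of the explicit part
(`ginzburgLandau_sub_le`, `mbe_energy_sub_le`). For Allen–Cahn the remainder is controlled only on
[-1, 1], hence the maximum principle `allenCahn_abs_le_one`.

Summing with the nonnegative weights t_k^α b_{n-k} leaves a quadratic form. If 𝒢 = -1, then μᵏ is a
negative multiple of ∑_j b_{k-j} vʲ, and the sum is a negative multiple of the integral of ∑_k t_k^α
b_{n-k} vᵏ ∑_{j≤k} b_{k-j} vʲ. If 𝒢 = Δ, one solves ∑_j b_{k-j} ψʲ = μᵏ, so that vᵏ = γ Δψᵏ;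
integration by parts gives the same form in each component of ∇ψ.

The form is nonnegative (`l1Coeff_form_nonneg`). In the variables w_k = b_{n-k} v_k its kernel is
k^α b_{k-j} / b_{n-j} for j ≤ k. Log-convexity of b and monotonicity of k^α b_{k-j} in k make this
kernel a nonnegative combination of indicators of triangles q ≤ j ≤ k ≤ p. Each indicator has form
½((∑ w)² + ∑ w²) over [q, p]. -/

theorem sum_triangle_mul_nonneg (w : ℕ → ℝ) (q p : ℕ) :
    0 ≤ ∑ k ∈ Finset.Icc q p, ∑ j ∈ Finset.Icc q k, w k * w j := by
  -- Symmetrization: doubling the triangle gives the full square plus one more copy of the diagonal.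
  have key : ∀ p, q ≤ p + 1 → 2 * ∑ k ∈ Finset.Icc q p, ∑ j ∈ Finset.Icc q k, w k * w j
      = (∑ k ∈ Finset.Icc q p, w k) ^ 2 + ∑ k ∈ Finset.Icc q p, w k ^ 2 := by
    intro p hp
    induction p with
    | zero =>
      rcases Nat.lt_or_ge 0 q with h | h
      · simp [Finset.Icc_eq_empty_of_lt h]
      · obtain rfl : q = 0 := by omega
        simp; ring
    | succ p ih =>
      rcases Nat.lt_or_ge (p + 1) q with h | h
      · simp [Finset.Icc_eq_empty_of_lt h]
      · rw [Finset.sum_Icc_succ_top h, Finset.sum_Icc_succ_top h, Finset.sum_Icc_succ_top h, mul_add,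
          ih h, ← Finset.mul_sum, Finset.sum_Icc_succ_top h]
        ring
  rcases Nat.lt_or_ge (p + 1) q with h | h
  · simp [Finset.Icc_eq_empty_of_lt (show p < q by omega)]
  · have := key p h
    have h2 : 0 ≤ ∑ k ∈ Finset.Icc q p, w k ^ 2 := Finset.sum_nonneg fun _ _ => sq_nonneg _
    nlinarith [sq_nonneg (∑ k ∈ Finset.Icc q p, w k)]

/-- The coefficient of w_k w_j collects the masses μ p q of all windows [q, p] containing j and k.
Exchanging the sums leaves one triangular form per window. -/
theorem sum_triangle_mixture_nonneg (n : ℕ) (μ : ℕ → ℕ → ℝ)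
    (hμ : ∀ p q, 1 ≤ q → q ≤ p → p ≤ n → 0 ≤ μ p q) (w : ℕ → ℝ) :
    0 ≤ ∑ k ∈ Finset.Icc 1 n, ∑ j ∈ Finset.Icc 1 k,
      (∑ p ∈ Finset.Icc k n, ∑ q ∈ Finset.Icc 1 j, μ p q) * (w k * w j) := by
  have h : ∑ k ∈ Finset.Icc 1 n, ∑ j ∈ Finset.Icc 1 k,
      (∑ p ∈ Finset.Icc k n, ∑ q ∈ Finset.Icc 1 j, μ p q) * (w k * w j)
      = ∑ p ∈ Finset.Icc 1 n, ∑ q ∈ Finset.Icc 1 p,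
        μ p q * ∑ k ∈ Finset.Icc q p, ∑ j ∈ Finset.Icc q k, w k * w j := by
    have e1 : ∀ k, ∑ j ∈ Finset.Icc 1 k,
        (∑ p ∈ Finset.Icc k n, ∑ q ∈ Finset.Icc 1 j, μ p q) * (w k * w j)
        = ∑ p ∈ Finset.Icc k n, ∑ q ∈ Finset.Icc 1 k, ∑ j ∈ Finset.Icc q k,
          μ p q * (w k * w j) := by
      intro k
      simp_rw [Finset.sum_mul]
      rw [Finset.sum_comm]
      refine Finset.sum_congr rfl fun p _ => ?_
      exact Finset.sum_comm' (by intro x y; simp only [Finset.mem_Icc]; omega)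
    simp_rw [e1, Finset.mul_sum]
    rw [Finset.sum_comm' (t' := Finset.Icc 1 n) (s' := fun p => Finset.Icc 1 p)
      (by intro x y; simp only [Finset.mem_Icc]; omega)]
    refine Finset.sum_congr rfl fun p _ => ?_
    exact Finset.sum_comm' (by intro x y; simp only [Finset.mem_Icc]; omega)
  rw [h]
  refine Finset.sum_nonneg fun p hp => Finset.sum_nonneg fun q hq => ?_
  simp only [Finset.mem_Icc] at hp hq
  exact mul_nonneg (hμ p q hq.1 hq.2 hp.2) (sum_triangle_mul_nonneg w q p)

theorem sum_Icc_backward_telescope (f : ℕ → ℝ) (j : ℕ) :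
    ∑ q ∈ Finset.Icc 1 j, (f q - f (q - 1)) = f j - f 0 := by
  induction j with
  | zero => simp
  | succ j ih => rw [Finset.sum_Icc_succ_top (by omega), ih]; simp

theorem sum_Icc_forward_telescope (f : ℕ → ℝ) {k n : ℕ} (h : k ≤ n) :
    ∑ p ∈ Finset.Icc k n, (f p - f (p + 1)) = f k - f (n + 1) := by
  induction n, h using Nat.le_induction with
  | base => simp
  | succ n hn ih => rw [Finset.sum_Icc_succ_top (by omega), ih]; ring

/-- A triangular kernel that decreases in the first index, increases in the second one and has
nonnegative mixed differences generates a nonnegative quadratic form. -/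
theorem sum_triangle_kernel_nonneg (n : ℕ) (s : ℕ → ℕ → ℝ)
    (h_nonneg : ∀ p q, 1 ≤ q → q ≤ p → p ≤ n → 0 ≤ s p q)
    (h_fst : ∀ p q, 1 ≤ q → q ≤ p → p < n → s (p + 1) q ≤ s p q)
    (h_snd : ∀ p q, 1 ≤ q → q < p → p ≤ n → s p q ≤ s p (q + 1))
    (h_mix : ∀ p q, 1 ≤ q → q < p → p < n →
      s p q - s (p + 1) q ≤ s p (q + 1) - s (p + 1) (q + 1)) (w : ℕ → ℝ) :
    0 ≤ ∑ k ∈ Finset.Icc 1 n, ∑ j ∈ Finset.Icc 1 k, s k j * (w k * w j) := by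
  -- Padding by zero at q = 0 and beyond p = n removes the boundary terms when the mixed differences
  -- μ telescope.
  set a : ℕ → ℕ → ℝ := fun p q => if q = 0 ∨ n < p then 0 else s p q with ha
  set μ : ℕ → ℕ → ℝ := fun p q => (a p q - a p (q - 1)) - (a (p + 1) q - a (p + 1) (q - 1))
    with hμ
  have tel : ∀ k j, k ≤ n →
      ∑ p ∈ Finset.Icc k n, ∑ q ∈ Finset.Icc 1 j, μ p q = a k j := by
    intro k j hk
    simp_rw [hμ, Finset.sum_sub_distrib (f := fun q => a _ q - a _ (q - 1)),
      sum_Icc_backward_telescope]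
    rw [sum_Icc_forward_telescope (fun p => a p j - a p 0) hk]
    simp [ha]
  have main := sum_triangle_mixture_nonneg n μ ?_ w
  · convert main using 1
    refine Finset.sum_congr rfl fun k hk => Finset.sum_congr rfl fun j hj => ?_
    simp only [Finset.mem_Icc] at hk hj
    rw [tel k j hk.2, ha]
    simp only
    rw [if_neg (by omega)]
  -- The four hypotheses are the four cases of μ ≥ 0: corner, edge q = 1, edge p = n, interior.
  · intro p q hq hqp hpn
    obtain ⟨q, rfl⟩ : ∃ r, q = r + 1 := ⟨q - 1, by omega⟩
    have hap : ¬ n < p := by omega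
    rcases Nat.eq_zero_or_pos q with rfl | hq0
    · rcases hpn.eq_or_lt with rfl | hlt
      · simpa [hμ, ha] using h_nonneg _ 1 le_rfl hqp le_rfl
      · simpa [hμ, ha, hap, show ¬ n ≤ p by omega] using h_fst p 1 le_rfl hqp hlt
    · have hq' : q ≠ 0 := by omega
      rcases hpn.eq_or_lt with rfl | hlt
      · simpa [hμ, ha, hq'] using h_snd _ q hq0 hqp le_rfl
      · have := h_mix p q hq0 hqp hlt
        simp only [hμ, ha, hap, show ¬ n < p + 1 by omega, hq', Nat.add_sub_cancel, or_self,
          if_false, Nat.succ_ne_zero]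
        linarith

/-! ### The L1 coefficients -/

section L1

variable {α : ℝ}

/-- The scale-free L1 coefficients `(m+1)^(1-α) - m^(1-α)`. -/
def l1Step (α : ℝ) (m : ℕ) : ℝ := ((m : ℝ) + 1) ^ (1 - α) - (m : ℝ) ^ (1 - α)

theorem l1Step_pos (hα1 : α < 1) (m : ℕ) : 0 < l1Step α m :=
  sub_pos.2 (Real.rpow_lt_rpow (by positivity) (by linarith) (by linarith))

/-- Log-convexity in a form linear in the coefficients, so that it survives integration. Since
`l1Step α m` is the increment of (m+s)^(1-α) over s ∈ [0, 1], it suffices that the corresponding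
quadratic in r with coefficients x^(-α), (x+1)^(-α), (x+2)^(-α) is nonnegative. -/
theorem l1Step_quadratic_nonneg (hα0 : 0 < α) (hα1 : α < 1) (m : ℕ) (r : ℝ) (hr : 0 ≤ r) :
    0 ≤ l1Step α m - 2 * r * l1Step α (m + 1) + r ^ 2 * l1Step α (m + 2) := by
  set h : ℝ → ℝ := fun s => ((m : ℝ) + s) ^ (1 - α) - 2 * r * ((m : ℝ) + 1 + s) ^ (1 - α)
    + r ^ 2 * ((m : ℝ) + 2 + s) ^ (1 - α) with hh
  have hm : (0 : ℝ) ≤ m := Nat.cast_nonneg m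
  have hmono : MonotoneOn h (Set.Icc 0 1) := by
    refine monotoneOn_of_hasDerivWithinAt_nonneg (convex_Icc 0 1) (f' := fun s =>
      (1 - α) * (((m : ℝ) + s) ^ (-α) - 2 * r * ((m : ℝ) + 1 + s) ^ (-α)
        + r ^ 2 * ((m : ℝ) + 2 + s) ^ (-α))) ?_ ?_ ?_
    · have hc : ∀ c : ℝ, Continuous fun s : ℝ => (c + s) ^ (1 - α) := fun c =>
        (continuous_const.add continuous_id).rpow_const fun _ => Or.inr (by linarith)
      exact (((hc _).sub (continuous_const.mul (hc _))).add
        (continuous_const.mul (hc _))).continuousOn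
    · intro s hs
      rw [interior_Icc] at hs
      have hd : ∀ c : ℝ, 0 ≤ c →
          HasDerivAt (fun s : ℝ => (c + s) ^ (1 - α)) ((1 - α) * (c + s) ^ (-α)) s := by
        intro c hc
        have := ((hasDerivAt_id s).const_add c).rpow_const (p := 1 - α)
          (Or.inl (by simp only [id]; linarith [hs.1]))
        rw [one_mul, show 1 - α - 1 = -α by ring] at this
        exact this
      refine HasDerivWithinAt.congr_deriv (((hd m hm).sub ((hd (m + 1) (by linarith)).const_mul (2 * r))).add
        ((hd (m + 2) (by linarith)).const_mul (r ^ 2))).hasDerivWithinAt ?_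
      ring
    · intro s hs
      rw [interior_Icc] at hs
      have hx : 0 < (m : ℝ) + s := by linarith [hs.1]
      refine mul_nonneg (by linarith) ?_
      set x := (m : ℝ) + s
      have e1 : (m : ℝ) + 1 + s = x + 1 := by ring
      have e2 : (m : ℝ) + 2 + s = x + 2 := by ring
      rw [e1, e2]
      have hsq : ∀ y : ℝ, 0 < y → y ^ (-α) = (y ^ (-α / 2)) ^ 2 := by
        intro y hy
        rw [← Real.rpow_natCast, ← Real.rpow_mul hy.le]
        congr 1; push_cast; ring
      -- This is (x+1)² ≥ x(x+2) raised to the nonpositive power -α/2.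
      have hmid : (x + 1) ^ (-α) ≤ x ^ (-α / 2) * (x + 2) ^ (-α / 2) := by
        rw [hsq _ (by linarith), sq, ← Real.mul_rpow (by linarith) (by linarith),
          ← Real.mul_rpow (by linarith) (by linarith)]
        exact Real.rpow_le_rpow_of_nonpos (by positivity) (by nlinarith) (by linarith)
      rw [hsq x hx, hsq (x + 2) (by linarith)]
      nlinarith [mul_le_mul_of_nonneg_left hmid hr,
        sq_nonneg (x ^ (-α / 2) - r * (x + 2) ^ (-α / 2))]
  have := hmono (Set.left_mem_Icc.2 zero_le_one) (Set.right_mem_Icc.2 zero_le_one) zero_le_one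
  simp only [hh, add_zero] at this
  simp only [l1Step]
  push_cast
  have e1 : (m : ℝ) + 1 + 1 = m + 2 := by ring
  rw [e1] at this ⊢
  linarith

/-- The discriminant inequality, obtained by taking r to be the minimizer of the quadratic. -/
theorem l1Step_sq_le (hα0 : 0 < α) (hα1 : α < 1) (m : ℕ) :
    l1Step α (m + 1) ^ 2 ≤ l1Step α m * l1Step α (m + 2) := by
  have h2 := l1Step_pos hα1 (m + 2)
  have h := l1Step_quadratic_nonneg hα0 hα1 m (l1Step α (m + 1) / l1Step α (m + 2))
    (div_nonneg (l1Step_pos hα1 _).le h2.le)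
  have e : l1Step α m - 2 * (l1Step α (m + 1) / l1Step α (m + 2)) * l1Step α (m + 1)
      + (l1Step α (m + 1) / l1Step α (m + 2)) ^ 2 * l1Step α (m + 2)
      = (l1Step α m * l1Step α (m + 2) - l1Step α (m + 1) ^ 2) / l1Step α (m + 2) := by
    field_simp; ring
  rw [e, le_div_iff₀ h2] at h
  linarith

/-- The ratios `b_(m+1) / b_m` increase. -/
theorem l1Step_mul_le (hα0 : 0 < α) (hα1 : α < 1) {m p : ℕ} (h : m ≤ p) :
    l1Step α (m + 1) * l1Step α p ≤ l1Step α m * l1Step α (p + 1) := by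
  induction p, h using Nat.le_induction with
  | base => exact (mul_comm _ _).le
  | succ p hp ih =>
    have h1 := l1Step_sq_le hα0 hα1 p
    have p0 := l1Step_pos hα1 p
    have p1 := l1Step_pos hα1 (p + 1)
    have q0 := l1Step_pos hα1 m
    have q1 := l1Step_pos hα1 (m + 1)
    refine le_of_mul_le_mul_right ?_ p0
    calc l1Step α (m + 1) * l1Step α (p + 1) * l1Step α p
        = (l1Step α (m + 1) * l1Step α p) * l1Step α (p + 1) := by ring
      _ ≤ (l1Step α m * l1Step α (p + 1)) * l1Step α (p + 1) := by gcongr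
      _ = l1Step α m * l1Step α (p + 1) ^ 2 := by ring
      _ ≤ l1Step α m * (l1Step α p * l1Step α (p + 2)) := by gcongr
      _ = l1Step α m * l1Step α (p + 1 + 1) * l1Step α p := by ring

/-- As y^α y^(1-α) = y, the claim is (m+1)^α m^(1-α) + 1 ≤ (m+2)^α (m+1)^(1-α). This is Hölder's
inequality for two terms, proved by two weighted AM–GM bounds whose right sides add up to 1. -/
theorem rpow_mul_l1Step_antitone (hα0 : 0 < α) (hα1 : α < 1) (m : ℕ) :
    ((m : ℝ) + 2) ^ α * l1Step α (m + 1) ≤ ((m : ℝ) + 1) ^ α * l1Step α m := by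
  have hm : (0 : ℝ) ≤ m := Nat.cast_nonneg m
  have e : ∀ y : ℝ, 0 < y → y ^ α * y ^ (1 - α) = y := by
    intro y hy
    rw [← Real.rpow_add hy]; simp
  have a1 := Real.geom_mean_le_arith_mean2_weighted hα0.le (by linarith : 0 ≤ 1 - α)
    (show 0 ≤ ((m : ℝ) + 1) / (m + 2) by positivity) (show 0 ≤ (m : ℝ) / (m + 1) by positivity)
    (by ring)
  have a2 := Real.geom_mean_le_arith_mean2_weighted hα0.le (by linarith : 0 ≤ 1 - α)
    (show 0 ≤ 1 / ((m : ℝ) + 2) by positivity) (show 0 ≤ 1 / ((m : ℝ) + 1) by positivity)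
    (by ring)
  have s1 : α * (((m : ℝ) + 1) / (m + 2)) + (1 - α) * (m / (m + 1))
      + (α * (1 / ((m : ℝ) + 2)) + (1 - α) * (1 / ((m : ℝ) + 1))) = 1 := by
    field_simp; ring
  have hsum := (add_le_add a1 a2).trans_eq s1
  rw [Real.div_rpow (by positivity) (by positivity), Real.div_rpow (by positivity) (by positivity),
    Real.div_rpow (by positivity) (by positivity), Real.div_rpow (by positivity) (by positivity),
    Real.one_rpow, Real.one_rpow, div_mul_div_comm, div_mul_div_comm, ← add_div,
    div_le_one (by positivity)] at hsum
  simp only [l1Step]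
  push_cast
  have e1 : (m : ℝ) + 1 + 1 = m + 2 := by ring
  rw [e1, mul_sub, mul_sub, e _ (by positivity), e _ (by positivity)]
  linarith

/-- With m = p - q, the case q = 1 is the preceding lemma. For q ≥ 1 the factor p^α grows relatively
more slowly: (p+1)/p ≤ (m+2)/(m+1). -/
theorem l1Step_kernel_antitone (hα0 : 0 < α) (hα1 : α < 1) {p q : ℕ} (hq : 1 ≤ q) (h : q ≤ p) :
    ((p + 1 : ℕ) : ℝ) ^ α * l1Step α (p + 1 - q) ≤ (p : ℝ) ^ α * l1Step α (p - q) := by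
  obtain ⟨m, rfl⟩ := Nat.exists_eq_add_of_le h
  obtain ⟨r, rfl⟩ := Nat.exists_eq_add_of_le hq
  have h1 := rpow_mul_l1Step_antitone hα0 hα1 m
  have hm : (0 : ℝ) ≤ m := Nat.cast_nonneg m
  have hr : (0 : ℝ) ≤ r := Nat.cast_nonneg r
  rw [show 1 + r + m + 1 - (1 + r) = m + 1 by omega, show 1 + r + m - (1 + r) = m by omega]
  push_cast
  have hp : ((1 : ℝ) + r + m + 1) / (m + 2) ≤ (1 + r + m) / (m + 1) := by
    rw [div_le_div_iff₀ (by positivity) (by positivity)]; nlinarith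
  have hpow := Real.rpow_le_rpow (by positivity) hp hα0.le
  have e1 : ((1 : ℝ) + r + m + 1) ^ α = (((1 : ℝ) + r + m + 1) / (m + 2)) ^ α * (m + 2) ^ α := by
    rw [← Real.mul_rpow (by positivity) (by positivity)]; congr 1; field_simp
  have e2 : ((1 : ℝ) + r + m) ^ α = (((1 : ℝ) + r + m) / (m + 1)) ^ α * (m + 1) ^ α := by
    rw [← Real.mul_rpow (by positivity) (by positivity)]; congr 1; field_simp
  rw [e1, e2, mul_assoc, mul_assoc]
  exact mul_le_mul hpow h1 (mul_nonneg (by positivity) (l1Step_pos hα1 _).le) (by positivity)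

/-- The weighted L1 quadratic form is nonnegative. -/
theorem l1Step_form_nonneg (hα0 : 0 < α) (hα1 : α < 1) (n : ℕ) (v : ℕ → ℝ) :
    0 ≤ ∑ k ∈ Finset.Icc 1 n, ∑ j ∈ Finset.Icc 1 k,
      ((k : ℝ) ^ α * l1Step α (n - k) * l1Step α (k - j)) * (v k * v j) := by
  have hpos := l1Step_pos hα1
  -- Absorbing b_{n-k} into the variable puts b_{n-j} in the denominator. That division makes the
  -- kernel increase in j, by monotonicity of the ratios.
  have main := sum_triangle_kernel_nonneg n
    (fun k j => (k : ℝ) ^ α * l1Step α (k - j) / l1Step α (n - j)) ?_ ?_ ?_ ?_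
    (fun k => l1Step α (n - k) * v k)
  · convert main using 1
    refine Finset.sum_congr rfl fun k _ => Finset.sum_congr rfl fun j _ => ?_
    have := (hpos (n - j)).ne'
    field_simp
  · intro p q _ _ _
    exact div_nonneg (mul_nonneg (by positivity) (hpos _).le) (hpos _).le
  · intro p q hq hqp hpn
    exact div_le_div_of_nonneg_right (l1Step_kernel_antitone hα0 hα1 hq hqp) (hpos _).le
  · intro p q hq hqp hpn
    obtain ⟨m, rfl⟩ := Nat.exists_eq_add_of_lt hqp
    obtain ⟨r, rfl⟩ := Nat.exists_eq_add_of_le hpn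
    have := l1Step_mul_le hα0 hα1 (show m ≤ m + r by omega)
    rw [show q + m + 1 - q = m + 1 by omega, show q + m + 1 - (q + 1) = m by omega,
      show q + m + 1 + r - q = m + r + 1 by omega, show q + m + 1 + r - (q + 1) = m + r by omega,
      div_le_div_iff₀ (hpos _) (hpos _)]
    nlinarith [Real.rpow_nonneg (Nat.cast_nonneg (q + m + 1) : (0 : ℝ) ≤ _) α]
  · intro p q hq hqp hpn
    obtain ⟨m, rfl⟩ := Nat.exists_eq_add_of_lt hqp
    obtain ⟨r, rfl⟩ := Nat.exists_eq_add_of_lt hpn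
    rw [← sub_div, ← sub_div, div_le_div_iff₀ (hpos _) (hpos _)]
    have hg := l1Step_kernel_antitone hα0 hα1 hq hqp.le
    have hP := Real.rpow_nonneg (Nat.cast_nonneg (q + m + 1) : (0 : ℝ) ≤ _) α
    rw [show q + m + 1 + 1 - q = m + 2 by omega, show q + m + 1 - q = m + 1 by omega] at hg ⊢
    rw [show q + m + 1 - (q + 1) = m by omega, show q + m + 1 + 1 - (q + 1) = m + 1 by omega,
      show q + m + 1 + r + 1 - (q + 1) = m + r + 1 by omega,
      show q + m + 1 + r + 1 - q = m + r + 2 by omega]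
    set P := ((q + m + 1 : ℕ) : ℝ) ^ α
    set Q := ((q + m + 1 + 1 : ℕ) : ℝ) ^ α
    have h1 := l1Step_sq_le hα0 hα1 m
    have h2 := l1Step_mul_le hα0 hα1 (show m + 1 ≤ m + r + 1 by omega)
    have p1 := hpos (m + 1)
    -- After multiplication by b_{m+1}, log-convexity lets P b_m − Q b_{m+1} factor out. This factor
    -- is nonnegative, and the remaining comparison is b_{m+2}/b_{m+1} ≤ b_{m+r+2}/b_{m+r+1}.
    refine le_of_mul_le_mul_right ?_ p1
    calc (P * l1Step α (m + 1) - Q * l1Step α (m + 2)) * l1Step α (m + r + 1) * l1Step α (m + 1)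
        = (P * l1Step α (m + 1) ^ 2 - Q * l1Step α (m + 2) * l1Step α (m + 1))
          * l1Step α (m + r + 1) := by ring
      _ ≤ (P * (l1Step α m * l1Step α (m + 2)) - Q * l1Step α (m + 2) * l1Step α (m + 1))
          * l1Step α (m + r + 1) := by
          have := (hpos (m + r + 1)).le
          gcongr
      _ = (P * l1Step α m - Q * l1Step α (m + 1)) *
          (l1Step α (m + 1 + 1) * l1Step α (m + r + 1)) := by ring
      _ ≤ (P * l1Step α m - Q * l1Step α (m + 1)) *
          (l1Step α (m + 1) * l1Step α (m + r + 1 + 1)) := by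
          have := l1Step_kernel_antitone hα0 hα1 (p := q + m + 1) (q := q + 1) (by omega) (by omega)
          rw [show q + m + 1 + 1 - (q + 1) = m + 1 by omega,
            show q + m + 1 - (q + 1) = m by omega] at this
          exact mul_le_mul_of_nonneg_left h2 (sub_nonneg.2 this)
      _ = _ := by ring

/-! ### The L1 coefficients with the time-step scale restored. -/

variable {τ : ℝ}

theorem l1Coeff_eq (m : ℕ) :
    l1Coeff α τ m = τ ^ (1 - α) / Real.Gamma (2 - α) * l1Step α m := rfl

theorem l1Scale_pos (hα1 : α < 1) (hτ : 0 < τ) : 0 < τ ^ (1 - α) / Real.Gamma (2 - α) :=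
  div_pos (Real.rpow_pos_of_pos hτ _) (Real.Gamma_pos_of_pos (by linarith))

theorem l1Coeff_pos (hα1 : α < 1) (hτ : 0 < τ) (m : ℕ) : 0 < l1Coeff α τ m :=
  mul_pos (l1Scale_pos hα1 hτ) (l1Step_pos hα1 m)

theorem l1Coeff_antitone (hα0 : 0 < α) (hα1 : α < 1) (hτ : 0 < τ) (m : ℕ) :
    l1Coeff α τ (m + 1) ≤ l1Coeff α τ m := by
  refine mul_le_mul_of_nonneg_left ?_ (l1Scale_pos hα1 hτ).le
  have h1 := rpow_mul_l1Step_antitone hα0 hα1 m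
  have h2 : ((m : ℝ) + 1) ^ α ≤ ((m : ℝ) + 2) ^ α :=
    Real.rpow_le_rpow (by positivity) (by linarith) hα0.le
  refine le_of_mul_le_mul_left ((mul_le_mul_of_nonneg_right h2 (l1Step_pos hα1 (m + 1)).le).trans h1)
    (by positivity)

/-- The weighted quadratic form of the L1 derivative is nonnegative. -/
theorem l1Coeff_form_nonneg (hα0 : 0 < α) (hα1 : α < 1) (hτ : 0 < τ) (n : ℕ) (v : ℕ → ℝ) :
    0 ≤ ∑ k ∈ Finset.Icc 1 n, ((k : ℝ) * τ) ^ α * l1Coeff α τ (n - k) *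
      (v k * ∑ j ∈ Finset.Icc 1 k, l1Coeff α τ (k - j) * v j) := by
  have h := l1Step_form_nonneg hα0 hα1 n v
  have hK := (l1Scale_pos hα1 hτ).le
  have : ∑ k ∈ Finset.Icc 1 n, ((k : ℝ) * τ) ^ α * l1Coeff α τ (n - k) *
      (v k * ∑ j ∈ Finset.Icc 1 k, l1Coeff α τ (k - j) * v j)
      = τ ^ α * (τ ^ (1 - α) / Real.Gamma (2 - α)) ^ 2 *
        ∑ k ∈ Finset.Icc 1 n, ∑ j ∈ Finset.Icc 1 k,
          ((k : ℝ) ^ α * l1Step α (n - k) * l1Step α (k - j)) * (v k * v j) := by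
    simp_rw [Finset.mul_sum, l1Coeff_eq]
    refine Finset.sum_congr rfl fun k _ => Finset.sum_congr rfl fun j _ => ?_
    rw [Real.mul_rpow (Nat.cast_nonneg k) hτ.le]
    ring
  rw [this]
  positivity

end L1

/-! ### Calculus of periodic functions on a cell -/

section Calculus

variable {d : ℕ} {ℓ : Fin d → ℝ}

open MeasureTheory

theorem cell_eq_preimage (ℓ : Fin d → ℝ) :
    cell ℓ = (WithLp.ofLp : EuclideanSpace ℝ (Fin d) → Fin d → ℝ) ⁻¹' Set.Icc 0 ℓ := by
  ext x
  simp [cell, Set.mem_Icc, Pi.le_def, forall_and]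

theorem isCompact_cell (ℓ : Fin d → ℝ) : IsCompact (cell ℓ) := by
  rw [cell_eq_preimage]
  exact (PiLp.homeomorph 2 (fun _ : Fin d => ℝ)).isCompact_preimage.2 isCompact_Icc

theorem _root_.Continuous.integrableOn_cell {f : EuclideanSpace ℝ (Fin d) → ℝ} (hf : Continuous f)
    (ℓ : Fin d → ℝ) : IntegrableOn f (cell ℓ) :=
  hf.continuousOn.integrableOn_compact (isCompact_cell ℓ)

theorem setIntegral_cell_mono {f g : EuclideanSpace ℝ (Fin d) → ℝ} (hf : Continuous f)
    (hg : Continuous g) (h : ∀ x ∈ cell ℓ, f x ≤ g x) :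
    ∫ x in cell ℓ, f x ≤ ∫ x in cell ℓ, g x :=
  setIntegral_mono_on (hf.integrableOn_cell ℓ) (hg.integrableOn_cell ℓ)
    (isCompact_cell ℓ).isClosed.measurableSet h

theorem setIntegral_cell_eq (f : EuclideanSpace ℝ (Fin d) → ℝ) :
    ∫ x in cell ℓ, f x = ∫ y in Set.Icc 0 ℓ, f (WithLp.toLp 2 y) := by
  rw [cell_eq_preimage, ← (PiLp.volume_preserving_ofLp (Fin d)).setIntegral_preimage_emb
    (MeasurableEquiv.toLp 2 (Fin d → ℝ)).symm.measurableEmbedding]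

theorem continuous_divergence {V : EuclideanSpace ℝ (Fin d) → EuclideanSpace ℝ (Fin d)}
    (hV : ContDiff ℝ 1 V) : Continuous (divergence V) := by
  have := hV.continuous_fderiv one_ne_zero
  unfold divergence
  fun_prop

theorem contDiff_divergence {n : WithTop ℕ∞}
    {V : EuclideanSpace ℝ (Fin d) → EuclideanSpace ℝ (Fin d)}
    (hV : ContDiff ℝ (n + 1) V) : ContDiff ℝ n (divergence V) := by
  have := hV.fderiv_right (m := n) le_rfl
  unfold divergence
  fun_prop

theorem contDiff_gradient {n : WithTop ℕ∞} {u : EuclideanSpace ℝ (Fin d) → ℝ}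
    (hu : ContDiff ℝ (n + 1) u) : ContDiff ℝ n (gradient u) :=
  (InnerProductSpace.toDual ℝ (EuclideanSpace ℝ (Fin d))).symm.contDiff.comp
    (hu.fderiv_right (m := n) le_rfl)

theorem gradient_apply (u : EuclideanSpace ℝ (Fin d) → ℝ) (x : EuclideanSpace ℝ (Fin d))
    (i : Fin d) : gradient u x i = fderiv ℝ u x (EuclideanSpace.single i 1) := by
  rw [← inner_gradient_left, EuclideanSpace.inner_single_right]
  simp

theorem divergence_gradient {v : EuclideanSpace ℝ (Fin d) → ℝ} (hv : ContDiff ℝ 2 v)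
    (x : EuclideanSpace ℝ (Fin d)) : divergence (gradient v) x = Δ v x := by
  rw [InnerProductSpace.laplacian_eq_iteratedFDeriv_orthonormalBasis v
    (EuclideanSpace.basisFun (Fin d) ℝ)]
  simp only [divergence]
  refine Finset.sum_congr rfl fun i _ => ?_
  rw [iteratedFDeriv_two_apply]
  have hd : DifferentiableAt ℝ (fderiv ℝ v) x :=
    ((hv.fderiv_right (m := 1) le_rfl).differentiable one_ne_zero) x
  have h := ((InnerProductSpace.toDual ℝ (EuclideanSpace ℝ (Fin d))).symm.toContinuousLinearEquiv
    |>.toContinuousLinearMap.hasFDerivAt.comp x hd.hasFDerivAt).fderiv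
  have e : fderiv ℝ (gradient v) x = _ := h
  rw [e]
  set A := fderiv ℝ (fderiv ℝ v) x (EuclideanSpace.single i 1)
  have : ((InnerProductSpace.toDual ℝ (EuclideanSpace ℝ (Fin d))).symm A) i
      = A (EuclideanSpace.single i 1) := by
    have := InnerProductSpace.toDual_symm_apply (𝕜 := ℝ) (x := EuclideanSpace.single i (1 : ℝ)) (y := A)
    rw [← this, EuclideanSpace.inner_single_right]
    simp
  simpa [A] using this

theorem laplacian_eq_divergence {v : EuclideanSpace ℝ (Fin d) → ℝ} (hv : ContDiff ℝ 2 v) :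
    Δ v = divergence (gradient v) :=
  funext fun x => (divergence_gradient hv x).symm

theorem contDiff_laplacian {n : WithTop ℕ∞} {v : EuclideanSpace ℝ (Fin d) → ℝ}
    (hv : ContDiff ℝ (n + 2) v) : ContDiff ℝ n (Δ v) := by
  rw [laplacian_eq_divergence (hv.of_le le_add_self)]
  refine contDiff_divergence (contDiff_gradient ?_)
  rwa [add_assoc, one_add_one_eq_two]

theorem continuous_laplacian {v : EuclideanSpace ℝ (Fin d) → ℝ} (hv : ContDiff ℝ 2 v) :
    Continuous (Δ v) :=
  (contDiff_laplacian (n := 0) (by simpa using hv)).continuous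

theorem continuous_gradient {v : EuclideanSpace ℝ (Fin d) → ℝ} (hv : ContDiff ℝ 1 v) :
    Continuous (gradient v) :=
  (contDiff_gradient (n := 0) (by simpa using hv)).continuous

theorem periodic_fderiv {F : Type*} [NormedAddCommGroup F] [NormedSpace ℝ F]
    {u : EuclideanSpace ℝ (Fin d) → F} {c : EuclideanSpace ℝ (Fin d)} (hu : Function.Periodic u c) :
    Function.Periodic (fderiv ℝ u) c := fun x => by
  rw [← fderiv_comp_add_right, funext hu]

theorem periodic_gradient {u : EuclideanSpace ℝ (Fin d) → ℝ} {c : EuclideanSpace ℝ (Fin d)}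
    (hu : Function.Periodic u c) : Function.Periodic (gradient u) c := fun x => by
  simp only [gradient, periodic_fderiv hu x]

theorem periodic_divergence {V : EuclideanSpace ℝ (Fin d) → EuclideanSpace ℝ (Fin d)}
    {c : EuclideanSpace ℝ (Fin d)} (hV : Function.Periodic V c) :
    Function.Periodic (divergence V) c := fun x => by
  simp only [divergence, periodic_fderiv hV x]

theorem periodic_laplacian {v : EuclideanSpace ℝ (Fin d) → ℝ} (hv : ContDiff ℝ 2 v)
    {c : EuclideanSpace ℝ (Fin d)} (hp : Function.Periodic v c) : Function.Periodic (Δ v) c := by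
  rw [laplacian_eq_divergence hv]
  exact periodic_divergence (periodic_gradient hp)

/-- The divergence theorem for a periodic vector field. -/
theorem integral_divergence_eq_zero (hd : 0 < d) (hℓ : ∀ i, 0 < ℓ i)
    {V : EuclideanSpace ℝ (Fin d) → EuclideanSpace ℝ (Fin d)} (hV : ContDiff ℝ 1 V)
    (hp : ∀ i, Function.Periodic V (EuclideanSpace.single i (ℓ i))) :
    ∫ x in cell ℓ, divergence V x = 0 := by
  obtain ⟨n, rfl⟩ : ∃ n, d = n + 1 := ⟨d - 1, by omega⟩
  -- The divergence theorem on boxes is stated for the plain product space, so the field is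
  -- transported there.
  set e := (PiLp.continuousLinearEquiv 2 ℝ (fun _ : Fin (n + 1) => ℝ)).symm.toContinuousLinearMap
    with he
  have hcomp : ∀ y, HasFDerivAt (fun y : Fin (n + 1) → ℝ => (V (WithLp.toLp 2 y)).ofLp)
      (((PiLp.continuousLinearEquiv 2 ℝ (fun _ : Fin (n + 1) => ℝ)).toContinuousLinearMap.comp
        (fderiv ℝ V (WithLp.toLp 2 y))).comp e) y := fun y =>
    ((PiLp.continuousLinearEquiv 2 ℝ
      (fun _ : Fin (n + 1) => ℝ)).toContinuousLinearMap.hasFDerivAt.comp y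
      (((hV.differentiable one_ne_zero) (WithLp.toLp 2 y)).hasFDerivAt.comp y e.hasFDerivAt) :)
  have hcont : Continuous (fun y : Fin (n + 1) → ℝ => (V (WithLp.toLp 2 y)).ofLp) :=
    continuous_iff_continuousAt.2 fun y => (hcomp y).continuousAt
  have main := integral_divergence_of_hasFDerivAt_off_countable (0 : Fin (n + 1) → ℝ) ℓ
    (fun i => (hℓ i).le) (fun y => (V (WithLp.toLp 2 y)).ofLp) _ ∅ Set.countable_empty
    hcont.continuousOn (fun x _ => hcomp x) ?_
  · rw [setIntegral_cell_eq]
    refine Eq.trans ?_ (main.trans ?_)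
    · rfl
    · refine Finset.sum_eq_zero fun i _ => sub_eq_zero.2 ?_
      refine integral_congr_ae (Filter.Eventually.of_forall fun x => ?_)
      -- Opposite faces differ by one period, so their fluxes cancel.
      have : WithLp.toLp 2 (i.insertNth (ℓ i) x)
          = WithLp.toLp 2 (i.insertNth (0 : ℝ) x) + EuclideanSpace.single i (ℓ i) := by
        ext j
        rcases Fin.eq_self_or_eq_succAbove i j with rfl | ⟨k, rfl⟩
        · simp
        · simp
      simp only [Pi.zero_apply]
      rw [this, hp i]
  · have := (continuous_divergence hV).comp e.continuous
    exact this.continuousOn.integrableOn_compact isCompact_Icc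

theorem divergence_smul {u : EuclideanSpace ℝ (Fin d) → ℝ}
    {V : EuclideanSpace ℝ (Fin d) → EuclideanSpace ℝ (Fin d)} {x : EuclideanSpace ℝ (Fin d)}
    (hu : DifferentiableAt ℝ u x) (hV : DifferentiableAt ℝ V x) :
    divergence (fun y => u y • V y) x = u x * divergence V x + inner ℝ (gradient u x) (V x) := by
  simp only [divergence, PiLp.inner_apply, gradient_apply, Finset.mul_sum, ← Finset.sum_add_distrib]
  refine Finset.sum_congr rfl fun i _ => ?_
  rw [fderiv_fun_smul hu hV]
  simp [mul_comm]

theorem integral_mul_divergence (hd : 0 < d) (hℓ : ∀ i, 0 < ℓ i)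
    {u : EuclideanSpace ℝ (Fin d) → ℝ} {V : EuclideanSpace ℝ (Fin d) → EuclideanSpace ℝ (Fin d)}
    (hu : ContDiff ℝ 1 u) (hV : ContDiff ℝ 1 V) (hpu : IsPeriodic ℓ u)
    (hpV : ∀ i, Function.Periodic V (EuclideanSpace.single i (ℓ i))) :
    ∫ x in cell ℓ, u x * divergence V x = -∫ x in cell ℓ, inner ℝ (gradient u x) (V x) := by
  have h := integral_divergence_eq_zero hd hℓ (hu.smul hV) (fun i x => by simp [hpu i x, hpV i x])
  have h1 : IntegrableOn (fun x => u x * divergence V x) (cell ℓ) :=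
    (hu.continuous.mul (continuous_divergence hV)).integrableOn_cell ℓ
  have h2 := ((continuous_gradient hu).inner hV.continuous (𝕜 := ℝ)).integrableOn_cell ℓ
  rw [eq_neg_iff_add_eq_zero, ← integral_add h1 h2, ← h]
  refine integral_congr_ae (Filter.Eventually.of_forall fun x => ?_)
  exact (divergence_smul (hu.differentiable one_ne_zero x) (hV.differentiable one_ne_zero x)).symm

theorem integral_mul_laplacian (hd : 0 < d) (hℓ : ∀ i, 0 < ℓ i)
    {u v : EuclideanSpace ℝ (Fin d) → ℝ} (hu : ContDiff ℝ 1 u) (hv : ContDiff ℝ 2 v)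
    (hpu : IsPeriodic ℓ u) (hpv : IsPeriodic ℓ v) :
    ∫ x in cell ℓ, u x * Δ v x = -∫ x in cell ℓ, inner ℝ (gradient u x) (gradient v x) := by
  rw [laplacian_eq_divergence hv]
  exact integral_mul_divergence hd hℓ hu (contDiff_gradient (by rwa [one_add_one_eq_two])) hpu
    fun i => periodic_gradient (hpv i)

/-- Green's second identity for periodic functions. -/
theorem integral_mul_laplacian_comm (hd : 0 < d) (hℓ : ∀ i, 0 < ℓ i)
    {u v : EuclideanSpace ℝ (Fin d) → ℝ} (hu : ContDiff ℝ 2 u) (hv : ContDiff ℝ 2 v)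
    (hpu : IsPeriodic ℓ u) (hpv : IsPeriodic ℓ v) :
    ∫ x in cell ℓ, u x * Δ v x = ∫ x in cell ℓ, v x * Δ u x := by
  rw [integral_mul_laplacian hd hℓ (hu.of_le one_le_two) hv hpu hpv,
    integral_mul_laplacian hd hℓ (hv.of_le one_le_two) hu hpv hpu]
  simp_rw [real_inner_comm]

theorem IsPeriodic.sub {u v : EuclideanSpace ℝ (Fin d) → ℝ} (hu : IsPeriodic ℓ u)
    (hv : IsPeriodic ℓ v) : IsPeriodic ℓ (fun x => u x - v x) := fun i x => by
  simp [hu i x, hv i x]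

/-- A continuous periodic function attains its maximum. -/
theorem IsPeriodic.exists_forall_le (hℓ : ∀ i, 0 < ℓ i) {u : EuclideanSpace ℝ (Fin d) → ℝ}
    (hu : IsPeriodic ℓ u) (hc : Continuous u) : ∃ x₀, ∀ x, u x ≤ u x₀ := by
  obtain ⟨x₀, -, hx₀⟩ := (isCompact_cell ℓ).exists_isMaxOn
    ⟨0, fun i => ⟨le_rfl, (hℓ i).le⟩⟩ hc.continuousOn
  refine ⟨x₀, fun x => ?_⟩
  -- Subtracting these multiples of the periods moves x into the cell.
  set k : Fin d → ℤ := fun i => ⌊x i / ℓ i⌋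
  have hsum : ∀ s : Finset (Fin d),
      u (x - ∑ i ∈ s, k i • EuclideanSpace.single i (ℓ i)) = u x := by
    intro s
    induction s using Finset.induction_on with
    | empty => simp
    | insert i s hi ih =>
      rw [Finset.sum_insert hi, add_comm, ← sub_sub, (hu i).sub_zsmul_eq, ih]
  rw [← hsum Finset.univ]
  refine hx₀ fun i => ?_
  have hval : (x - ∑ j, k j • EuclideanSpace.single j (ℓ j)) i = x i - k i * ℓ i := by
    simp [Finset.sum_apply, Pi.single_apply]
  rw [hval]
  have h1 := Int.floor_le (x i / ℓ i)
  have h2 := (Int.lt_floor_add_one (x i / ℓ i)).le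
  rw [le_div_iff₀ (hℓ i)] at h1
  rw [div_le_iff₀ (hℓ i)] at h2
  constructor
  · simpa [k] using h1
  · simp only [k]; linarith

/-- A positive second derivative would make the maximum point a local minimum too. Then g would be
locally constant, with second derivative zero. -/
theorem deriv_deriv_nonpos_of_forall_le {g : ℝ → ℝ} (hg : ContDiff ℝ 2 g) {t : ℝ}
    (h : ∀ s, g s ≤ g t) : deriv (deriv g) t ≤ 0 := by
  by_contra! hpos
  have hmax : IsLocalMax g t := Filter.Eventually.of_forall h
  have hmin := isLocalMin_of_deriv_deriv_pos hpos hmax.deriv_eq_zero hg.continuous.continuousAt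
  have hconst : g =ᶠ[nhds t] fun _ => g t := by
    filter_upwards [hmin] with s hs using le_antisymm (h s) hs
  have := hconst.deriv.deriv_eq
  simp at this
  linarith

/-- The Laplacian is nonpositive at a maximum. -/
theorem laplacian_nonpos_of_forall_le {v : EuclideanSpace ℝ (Fin d) → ℝ} (hv : ContDiff ℝ 2 v)
    {x₀ : EuclideanSpace ℝ (Fin d)} (h : ∀ x, v x ≤ v x₀) : Δ v x₀ ≤ 0 := by
  rw [InnerProductSpace.laplacian_eq_iteratedFDeriv_orthonormalBasis v
    (EuclideanSpace.basisFun (Fin d) ℝ)]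
  refine Finset.sum_nonpos fun i _ => ?_
  set b := EuclideanSpace.basisFun (Fin d) ℝ i
  have hline : ∀ t : ℝ, HasDerivAt (fun t : ℝ => x₀ + t • b) b t := fun t => by
    simpa using ((hasDerivAt_id t).smul_const b).const_add x₀
  have hd1 : deriv (fun t : ℝ => v (x₀ + t • b)) = fun t => fderiv ℝ v (x₀ + t • b) b :=
    funext fun t =>
      (((hv.differentiable two_ne_zero _).hasFDerivAt).comp_hasDerivAt t (hline t)).deriv
  have hdf : Differentiable ℝ (fderiv ℝ v) :=
    (hv.fderiv_right (m := 1) le_rfl).differentiable one_ne_zero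
  have hd2 : deriv (deriv (fun t : ℝ => v (x₀ + t • b))) 0 = fderiv ℝ (fderiv ℝ v) x₀ b b := by
    rw [hd1]
    have h1 := (hdf (x₀ + (0 : ℝ) • b)).hasFDerivAt.comp_hasDerivAt 0 (hline 0)
    have h2 := (h1.clm_apply (hasDerivAt_const (0 : ℝ) b)).deriv
    simpa using h2
  rw [iteratedFDeriv_two_apply]
  have := deriv_deriv_nonpos_of_forall_le (g := fun t : ℝ => v (x₀ + t • b))
    (hv.comp (by fun_prop)) (t := 0) (by intro s; simpa using h _)
  rw [hd2] at this
  simpa using this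

end Calculus

/-! ### One-step energy estimates -/

section Energy

variable {d : ℕ} {ℓ : Fin d → ℝ}

open MeasureTheory

/-- Only an upper bound on the second derivative is assumed; this one-sidedness yields the constant
1/16 for the MBE model. -/
theorem le_taylor_of_deriv2_le {g g' g'' : ℝ → ℝ} {C : ℝ} (h1 : ∀ t, HasDerivAt g (g' t) t)
    (h2 : ∀ t, HasDerivAt g' (g'' t) t) (hC : ∀ t, g'' t ≤ C) : g 1 ≤ g 0 + g' 0 + C / 2 := by
  have hanti : Antitone fun t => g' t - C * t := by
    refine antitone_of_deriv_nonpos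
      (fun t => ((h2 t).sub ((hasDerivAt_id t).const_mul C)).differentiableAt) fun t => ?_
    have := ((h2 t).sub ((hasDerivAt_id t).const_mul C)).deriv
    refine le_of_eq_of_le this ?_
    linarith [hC t]
  have hd : ∀ t, HasDerivAt (fun t => g t - g' 0 * t - C / 2 * t ^ 2) (g' t - g' 0 - C * t) t := by
    intro t
    refine HasDerivAt.congr_deriv (((h1 t).sub ((hasDerivAt_id t).const_mul (g' 0))).sub
      ((hasDerivAt_pow 2 t).const_mul (C / 2))) ?_
    push_cast; ring
  have := antitoneOn_of_deriv_nonpos (convex_Icc (0 : ℝ) 1)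
    (fun t _ => (hd t).continuousAt.continuousWithinAt)
    (fun t _ => (hd t).differentiableAt.differentiableWithinAt) (fun t ht => by
      rw [interior_Icc] at ht
      have := hanti ht.1.le
      simp only [mul_zero, sub_zero] at this
      rw [(hd t).deriv]; linarith)
    (Set.left_mem_Icc.2 zero_le_one) (Set.right_mem_Icc.2 zero_le_one) zero_le_one
  simp only at this
  linarith

theorem potential_sub_le {F : ℝ → ℝ} {L : ℝ} (hF : ContDiff ℝ 2 F)
    (hL : ∀ s, |deriv (deriv F) s| ≤ L) (a b : ℝ) :
    F b - F a ≤ deriv F a * (b - a) + L / 2 * (b - a) ^ 2 := by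
  have hF1 : ContDiff ℝ 1 (deriv F) :=
    ((contDiff_succ_iff_deriv (n := 1)).1 (by rwa [one_add_one_eq_two])).2.2
  have hline : ∀ t, HasDerivAt (fun t : ℝ => a + t * (b - a)) (b - a) t := fun t => by
    simpa using ((hasDerivAt_id t).mul_const (b - a)).const_add a
  have := le_taylor_of_deriv2_le (C := L * (b - a) ^ 2)
    (g := fun t => F (a + t * (b - a)))
    (fun t => ((hF.differentiable two_ne_zero _).hasDerivAt).comp t (hline t))
    (fun t => (((hF1.differentiable one_ne_zero _).hasDerivAt).comp t (hline t)).mul_const (b - a))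
    (fun t => by
      rw [mul_assoc, ← sq]
      exact mul_le_mul_of_nonneg_right ((le_abs_self _).trans (hL _)) (sq_nonneg _))
  simp only [one_mul, zero_mul, add_zero, add_sub_cancel] at this
  linarith

theorem deriv_doubleWell (s : ℝ) : deriv doubleWell s = s ^ 3 - s := by
  have : HasDerivAt doubleWell (s ^ 3 - s) s := by
    refine HasDerivAt.congr_deriv
      ((((hasDerivAt_pow 2 s).const_sub 1).fun_pow 2).div_const 4) ?_
    push_cast; ring
  exact this.deriv

/-- The Taylor remainder is (b-a)² (b² + 2ab + 3a² - 2)/4, and the second factor is at most 4 on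
[-1, 1]. -/
theorem doubleWell_sub_le {a b : ℝ} (ha : |a| ≤ 1) (hb : |b| ≤ 1) :
    doubleWell b - doubleWell a ≤ deriv doubleWell a * (b - a) + (b - a) ^ 2 := by
  rw [deriv_doubleWell]
  have ha2 := (sq_le_one_iff_abs_le_one a).2 ha
  have hb2 := (sq_le_one_iff_abs_le_one b).2 hb
  have : 0 ≤ (b - a) ^ 2 * (6 - (b ^ 2 + 2 * a * b + 3 * a ^ 2)) :=
    mul_nonneg (sq_nonneg _) (by nlinarith [sq_nonneg (a - b)])
  simp only [doubleWell]
  nlinarith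

/-- Along the segment, put Q = 1 + |p+th|². By Cauchy–Schwarz the second derivative of -½ log Q is
at most |h|² (Q-2)/Q², and (Q-4)² ≥ 0 bounds this by |h|²/8. Taylor's formula halves the constant.
-/
theorem log_norm_sq_sub_le {E : Type*} [NormedAddCommGroup E] [InnerProductSpace ℝ E] (p q : E) :
    1 / 2 * Real.log (1 + ‖p‖ ^ 2) - 1 / 2 * Real.log (1 + ‖q‖ ^ 2) ≤
      -(1 / (1 + ‖p‖ ^ 2) * inner ℝ p (q - p)) + 1 / 16 * ‖q - p‖ ^ 2 := by
  set h := q - p with hh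
  have hq : q = p + (1 : ℝ) • h := by simp [hh]
  have hQ : ∀ t : ℝ, 0 < 1 + ‖p + t • h‖ ^ 2 := fun t => by positivity
  have hline : ∀ t : ℝ, HasDerivAt (fun t : ℝ => p + t • h) h t := fun t => by
    simpa using ((hasDerivAt_id t).smul_const h).const_add p
  have hsq : ∀ t : ℝ, HasDerivAt (fun t : ℝ => 1 + ‖p + t • h‖ ^ 2)
      (2 * inner ℝ (p + t • h) h) t := fun t => (hline t).norm_sq.const_add 1
  have hin : ∀ t : ℝ, HasDerivAt (fun t : ℝ => inner ℝ (p + t • h) h) (‖h‖ ^ 2) t := fun t => by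
    simpa using (hline t).inner ℝ (hasDerivAt_const t h)
  have := le_taylor_of_deriv2_le (C := ‖h‖ ^ 2 / 8)
    (g := fun t : ℝ => -(1 / 2 * Real.log (1 + ‖p + t • h‖ ^ 2)))
    (g' := fun t : ℝ => -(inner ℝ (p + t • h) h / (1 + ‖p + t • h‖ ^ 2)))
    (fun t => HasDerivAt.congr_deriv (((hsq t).log (hQ t).ne').const_mul (1 / 2)).fun_neg (by ring))
    (fun t => ((hin t).fun_div (hsq t) (hQ t).ne').fun_neg) (fun t => by
      have hcs := abs_real_inner_le_norm (p + t • h) h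
      have hcs2 : inner ℝ (p + t • h) h ^ 2 ≤ ‖p + t • h‖ ^ 2 * ‖h‖ ^ 2 := by
        rw [← mul_pow, ← sq_abs]; gcongr
      have hq := hQ t
      have hX : ‖p + t • h‖ ^ 2 = (1 + ‖p + t • h‖ ^ 2) - 1 := by ring
      rw [hX] at hcs2
      set Q := 1 + ‖p + t • h‖ ^ 2
      rw [← neg_div, div_le_iff₀ (by positivity)]
      nlinarith [mul_nonneg (sq_nonneg ‖h‖) (sq_nonneg (Q - 4))])
  simp only [zero_smul, add_zero, ← hq] at this
  rw [one_div_mul_eq_div (1 + ‖p‖ ^ 2) (inner ℝ p h)]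
  linarith

theorem gradient_fun_sub {u v : EuclideanSpace ℝ (Fin d) → ℝ} {x : EuclideanSpace ℝ (Fin d)}
    (hv : DifferentiableAt ℝ v x) (hu : DifferentiableAt ℝ u x) :
    gradient (fun y => v y - u y) x = gradient v x - gradient u x := by
  simp only [gradient, fderiv_fun_sub hv hu, map_sub]

/-- Convexity of the square: the discarded term is |q-p|². This is what evaluating the quadratic
energy at the new time level gains. -/
theorem norm_sq_sub_norm_sq_le {E : Type*} [NormedAddCommGroup E] [InnerProductSpace ℝ E]
    (p q : E) : ‖q‖ ^ 2 - ‖p‖ ^ 2 ≤ 2 * inner ℝ (q - p) q := by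
  have h := norm_sub_sq_real q p
  rw [inner_sub_left, real_inner_self_eq_norm_sq, real_inner_comm]
  nlinarith [sq_nonneg ‖q - p‖]

/-- The one-step estimate for the Ginzburg-Landau energy. -/
theorem ginzburgLandau_sub_le (hd : 0 < d) (hℓ : ∀ i, 0 < ℓ i) {ε S : ℝ} {F : ℝ → ℝ}
    (hF : ContDiff ℝ 1 F) {u v : EuclideanSpace ℝ (Fin d) → ℝ} (hu : ContDiff ℝ 1 u)
    (hv : ContDiff ℝ 2 v) (hpu : IsPeriodic ℓ u) (hpv : IsPeriodic ℓ v)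
    (hS : ∀ x, F (v x) - F (u x) ≤ deriv F (u x) * (v x - u x) + S * (v x - u x) ^ 2) :
    (∫ x in cell ℓ, (ε ^ 2 / 2 * ‖gradient v x‖ ^ 2 + F (v x))) -
        ∫ x in cell ℓ, (ε ^ 2 / 2 * ‖gradient u x‖ ^ 2 + F (u x)) ≤
      ∫ x in cell ℓ, (-(ε ^ 2 * Δ v x) + deriv F (u x) + S * (v x - u x)) * (v x - u x) := by
  have hv1 : ContDiff ℝ 1 v := hv.of_le one_le_two
  have hw : ContDiff ℝ 1 fun x => v x - u x := hv1.sub hu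
  have cu := hu.continuous
  have cv := hv.continuous
  have cgu := continuous_gradient hu
  have cgv := continuous_gradient hv1
  have cgw := continuous_gradient hw
  have cl := continuous_laplacian hv
  have cF := hF.continuous
  have cF' := hF.continuous_deriv le_rfl
  have ibp := integral_mul_laplacian hd hℓ hw hv (hpv.sub hpu) hpv
  set R : EuclideanSpace ℝ (Fin d) → ℝ :=
    fun x => (deriv F (u x) + S * (v x - u x)) * (v x - u x) with hR
  have cR : Continuous R := by fun_prop
  have split : ∫ x in cell ℓ, (-(ε ^ 2 * Δ v x) + deriv F (u x) + S * (v x - u x)) * (v x - u x)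
      = ∫ x in cell ℓ,
        (ε ^ 2 * inner ℝ (gradient (fun y => v y - u y) x) (gradient v x) + R x) := by
    have i1 : IntegrableOn (fun x => (v x - u x) * Δ v x) (cell ℓ) :=
      Continuous.integrableOn_cell (by fun_prop) ℓ
    have i2 : IntegrableOn
        (fun x => (inner ℝ (gradient (fun y => v y - u y) x) (gradient v x) : ℝ)) (cell ℓ) :=
      Continuous.integrableOn_cell (by fun_prop) ℓ
    have iR := cR.integrableOn_cell ℓ
    rw [integral_add (i2.const_mul _) iR, integral_const_mul, ← neg_eq_iff_eq_neg.2 ibp, mul_neg,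
      ← neg_mul, ← integral_const_mul, ← integral_add (i1.const_mul _) iR]
    refine integral_congr_ae (Filter.Eventually.of_forall fun x => ?_)
    simp only [hR]; ring
  rw [split, ← integral_sub (Continuous.integrableOn_cell (by fun_prop) ℓ)
    (Continuous.integrableOn_cell (by fun_prop) ℓ)]
  refine setIntegral_cell_mono (by fun_prop) (by fun_prop) fun x _ => ?_
  rw [gradient_fun_sub (hv1.differentiable one_ne_zero x) (hu.differentiable one_ne_zero x)]
  have h1 := mul_le_mul_of_nonneg_left (norm_sq_sub_norm_sq_le (gradient u x) (gradient v x))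
    (by positivity : 0 ≤ ε ^ 2 / 2)
  have h2 := hS x
  simp only [hR]
  nlinarith

theorem contDiff_mbeFlux : ContDiff ℝ 1 (mbeFlux : EuclideanSpace ℝ (Fin d) → _) := by
  have h : ContDiff ℝ 1 fun p : EuclideanSpace ℝ (Fin d) => 1 + ‖p‖ ^ 2 :=
    contDiff_const.add (contDiff_norm_sq ℝ)
  exact (contDiff_const.div h fun p => by positivity).smul contDiff_id

/-- The one-step estimate for the energy of the MBE model. -/
theorem mbe_energy_sub_le (hd : 0 < d) (hℓ : ∀ i, 0 < ℓ i) {ε S : ℝ} (hS : 1 / 16 ≤ S)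
    {u v : EuclideanSpace ℝ (Fin d) → ℝ} (hu : ContDiff ℝ 2 u)
    (hv : ContDiff ℝ 4 v) (hpu : IsPeriodic ℓ u) (hpv : IsPeriodic ℓ v) :
    (∫ x in cell ℓ, (ε ^ 2 / 2 * (Δ v x) ^ 2 - 1 / 2 * Real.log (1 + ‖gradient v x‖ ^ 2))) -
        ∫ x in cell ℓ, (ε ^ 2 / 2 * (Δ u x) ^ 2 - 1 / 2 * Real.log (1 + ‖gradient u x‖ ^ 2)) ≤
      ∫ x in cell ℓ, (ε ^ 2 * Δ (Δ v) x + divergence (fun y => mbeFlux (gradient u y)) x +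
        -(S * Δ (fun y => v y - u y) x)) * (v x - u x) := by
  have hv2 : ContDiff ℝ 2 v := hv.of_le (by norm_num)
  have hlv : ContDiff ℝ 2 (Δ v) := contDiff_laplacian (by norm_num; exact hv)
  have hw : ContDiff ℝ 2 fun x => v x - u x := hv2.sub hu
  have hw1 : ContDiff ℝ 1 fun x => v x - u x := hw.of_le one_le_two
  have hpw := hpv.sub hpu
  have hgu : ContDiff ℝ 1 (gradient u) := contDiff_gradient (by rwa [one_add_one_eq_two])
  have hfl : ContDiff ℝ 1 fun x => mbeFlux (gradient u x) := contDiff_mbeFlux.comp hgu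
  have cu := hu.continuous
  have cv := hv.continuous
  have cgu := hgu.continuous
  have cgv := continuous_gradient (hv2.of_le one_le_two)
  have cgw := continuous_gradient hw1
  have clu := continuous_laplacian hu
  have clv := hlv.continuous
  have clw := continuous_laplacian hw
  have cllv := continuous_laplacian hlv
  have cfl := hfl.continuous
  have cdiv := continuous_divergence hfl
  -- Green's identity puts one Laplacian on v - u, which is only C² because u is.
  have ibp1 := integral_mul_laplacian_comm hd hℓ hw hlv hpw fun i => periodic_laplacian hv2 (hpv i)
  have ibp2 := integral_mul_divergence hd hℓ hw1 hfl hpw fun i x => by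
    simp only [periodic_gradient (hpu i) x]
  have ibp3 := integral_mul_laplacian hd hℓ hw1 hw hpw hpw
  set w : EuclideanSpace ℝ (Fin d) → ℝ := fun x => v x - u x with hwdef
  have cw : Continuous w := hw.continuous
  have split : ∫ x in cell ℓ, (ε ^ 2 * Δ (Δ v) x + divergence (fun y => mbeFlux (gradient u y)) x +
        -(S * Δ w x)) * (v x - u x)
      = ∫ x in cell ℓ, (ε ^ 2 * (Δ v x * Δ w x)
        - inner ℝ (gradient w x) (mbeFlux (gradient u x))
        + S * inner ℝ (gradient w x) (gradient w x)) := by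
    have i1 : IntegrableOn (fun x => w x * Δ (Δ v) x) (cell ℓ) :=
      Continuous.integrableOn_cell (by fun_prop) ℓ
    have i2 : IntegrableOn (fun x => w x * divergence (fun y => mbeFlux (gradient u y)) x)
      (cell ℓ) := Continuous.integrableOn_cell (by fun_prop) ℓ
    have i3 : IntegrableOn (fun x => w x * Δ w x) (cell ℓ) :=
      Continuous.integrableOn_cell (by fun_prop) ℓ
    have j1 : IntegrableOn (fun x => Δ v x * Δ w x) (cell ℓ) :=
      Continuous.integrableOn_cell (by fun_prop) ℓ
    have j2 : IntegrableOn (fun x => (inner ℝ (gradient w x) (mbeFlux (gradient u x)) : ℝ))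
      (cell ℓ) := Continuous.integrableOn_cell (by fun_prop) ℓ
    have j3 : IntegrableOn (fun x => (inner ℝ (gradient w x) (gradient w x) : ℝ)) (cell ℓ) :=
      Continuous.integrableOn_cell (by fun_prop) ℓ
    have i12 : IntegrableOn (fun x => ε ^ 2 * (w x * Δ (Δ v) x) +
        w x * divergence (fun y => mbeFlux (gradient u y)) x) (cell ℓ) := (i1.const_mul _).add i2
    have j12 : IntegrableOn (fun x => ε ^ 2 * (Δ v x * Δ w x) -
        inner ℝ (gradient w x) (mbeFlux (gradient u x))) (cell ℓ) := (j1.const_mul _).sub j2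
    rw [integral_add j12 (j3.const_mul _), integral_sub (j1.const_mul _) j2,
      integral_const_mul, integral_const_mul, ← ibp1, sub_eq_add_neg, ← ibp2,
      ← neg_eq_iff_eq_neg.2 ibp3, mul_neg, ← neg_mul, ← integral_const_mul, ← integral_const_mul,
      ← integral_add (i1.const_mul _) i2, ← integral_add i12 (i3.const_mul _)]
    refine integral_congr_ae (Filter.Eventually.of_forall fun x => ?_)
    simp only [hwdef]; ring
  have clog : ∀ {g : EuclideanSpace ℝ (Fin d) → EuclideanSpace ℝ (Fin d)}, Continuous g →
      Continuous fun x => Real.log (1 + ‖g x‖ ^ 2) := fun hg =>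
    Continuous.log (by fun_prop) fun x => by positivity
  have clogu := clog cgu
  have clogv := clog cgv
  rw [split, ← integral_sub (Continuous.integrableOn_cell (by fun_prop) ℓ)
    (Continuous.integrableOn_cell (by fun_prop) ℓ)]
  refine setIntegral_cell_mono (by fun_prop) (by fun_prop) fun x _ => ?_
  have hlap : Δ w x = Δ v x - Δ u x := hv2.contDiffAt.laplacian_sub hu.contDiffAt
  rw [hlap, gradient_fun_sub (hv2.differentiable two_ne_zero x) (hu.differentiable two_ne_zero x),
    real_inner_self_eq_norm_sq, mbeFlux, inner_smul_right, real_inner_comm (gradient u x)]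
  have h1 := log_norm_sq_sub_le (gradient u x) (gradient v x)
  have h2 := mul_le_mul_of_nonneg_right hS (sq_nonneg ‖gradient v x - gradient u x‖)
  have h3 : 0 ≤ ε ^ 2 / 2 * (Δ v x - Δ u x) ^ 2 := by positivity
  nlinarith

end Energy

/-! ### The maximum principle for the Allen-Cahn scheme -/

section MaximumPrinciple

variable {d : ℕ} {ℓ : Fin d → ℝ} {α τ : ℝ}

theorem l1Deriv_neg (u : ℕ → ℝ) (n : ℕ) : l1Deriv α τ (fun k => -u k) n = -l1Deriv α τ u n := by
  simp only [l1Deriv, backwardDiff, ← Finset.sum_neg_distrib]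
  exact Finset.sum_congr rfl fun j _ => by ring

/-- A lower bound for the L1 derivative of a sequence with history bounded by `1`. -/
theorem l1Coeff_zero_mul_le_l1Deriv (hα0 : 0 < α) (hα1 : α < 1) (hτ : 0 < τ) {u : ℕ → ℝ} {n : ℕ}
    (hu : ∀ j ≤ n, u j ≤ 1) :
    l1Coeff α τ 0 * ((u (n + 1) - 1) / τ) ≤ l1Deriv α τ u (n + 1) := by
  -- Summation by parts, by induction on the truncation m. Since (u m - 1)/τ ≤ 0 for m ≤ n, passing
  -- to the next, larger coefficient only lowers the bound.
  have key : ∀ m ≤ n + 1, l1Coeff α τ (n + 1 - m) * ((u m - 1) / τ) ≤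
      ∑ j ∈ Finset.Icc 1 m, l1Coeff α τ (n + 1 - j) * backwardDiff τ u j := by
    intro m hm
    induction m with
    | zero =>
      simp only [Finset.Icc_eq_empty_of_lt Nat.zero_lt_one, Finset.sum_empty]
      exact mul_nonpos_of_nonneg_of_nonpos (l1Coeff_pos hα1 hτ _).le
        (div_nonpos_of_nonpos_of_nonneg (by linarith [hu 0 (Nat.zero_le n)]) hτ.le)
    | succ m ih =>
      rw [Finset.sum_Icc_succ_top (by omega)]
      refine le_trans ?_ (add_le_add_left (ih (by omega)) _)
      have hb := l1Coeff_antitone hα0 hα1 hτ (n + 1 - (m + 1))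
      rw [show n + 1 - (m + 1) + 1 = n + 1 - m by omega] at hb
      have hy : (u m - 1) / τ ≤ 0 :=
        div_nonpos_of_nonpos_of_nonneg (by linarith [hu m (by omega)]) hτ.le
      have := mul_le_mul_of_nonpos_right hb hy
      have e : backwardDiff τ u (m + 1) = (u (m + 1) - 1) / τ - (u m - 1) / τ := by
        simp only [backwardDiff, Nat.add_sub_cancel]; ring
      rw [e]
      linarith
  simpa [l1Deriv] using key (n + 1) le_rfl

/-- At a maximum above 1 the L1 derivative is positive and the Laplacian nonpositive. The other
terms are at most -(1-φⁿ)(S - φⁿ - (φⁿ)²), which is nonpositive because S ≥ 2 and |φⁿ| ≤ 1. -/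
theorem allenCahn_step_le_one (hα0 : 0 < α) (hα1 : α < 1) (hτ : 0 < τ) (hℓ : ∀ i, 0 < ℓ i)
    {γ ε S : ℝ} (hγ : 0 < γ) (hS : 2 ≤ S) {φ : ℕ → EuclideanSpace ℝ (Fin d) → ℝ} {n : ℕ}
    (hφ : ContDiff ℝ 2 (φ (n + 1))) (hp : IsPeriodic ℓ (φ (n + 1)))
    (hb : ∀ j ≤ n, ∀ x, |φ j x| ≤ 1)
    (heq : ∀ x, l1Deriv α τ (fun k => φ k x) (n + 1) = γ * (ε ^ 2 * Δ (φ (n + 1)) x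
      + φ n x - φ n x ^ 3 + S * (φ n x - φ (n + 1) x))) (x : EuclideanSpace ℝ (Fin d)) :
    φ (n + 1) x ≤ 1 := by
  obtain ⟨x₀, hx₀⟩ := hp.exists_forall_le hℓ hφ.continuous
  refine (hx₀ x).trans ?_
  by_contra! hgt
  have h1 := l1Coeff_zero_mul_le_l1Deriv hα0 hα1 hτ (u := fun k => φ k x₀) (n := n)
    fun j hj => (abs_le.1 (hb j hj x₀)).2
  have h2 : 0 < l1Coeff α τ 0 * ((φ (n + 1) x₀ - 1) / τ) :=
    mul_pos (l1Coeff_pos hα1 hτ 0) (div_pos (by linarith) hτ)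
  have h3 := h2.trans_le h1
  rw [heq x₀] at h3
  have h4 := pos_of_mul_pos_right h3 hγ.le
  have h5 := mul_nonpos_of_nonneg_of_nonpos (sq_nonneg ε) (laplacian_nonpos_of_forall_le hφ hx₀)
  obtain ⟨hl, hr⟩ := abs_le.1 (hb n le_rfl x₀)
  have h6 : 0 ≤ (1 - φ n x₀) * (S - φ n x₀ - φ n x₀ ^ 2) :=
    mul_nonneg (by linarith) (by nlinarith)
  nlinarith

theorem allenCahn_abs_le_one (hα0 : 0 < α) (hα1 : α < 1) (hτ : 0 < τ) (hℓ : ∀ i, 0 < ℓ i)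
    {γ ε S : ℝ} (hγ : 0 < γ) (hS : 2 ≤ S) {N : ℕ} {φ : ℕ → EuclideanSpace ℝ (Fin d) → ℝ}
    (hφ : Model.allenCahn.IsL1Solution α τ γ ε S ℓ N φ) (h0 : ∀ x, |φ 0 x| ≤ 1) :
    ∀ n ≤ N, ∀ x, |φ n x| ≤ 1 := by
  intro n
  induction n using Nat.strong_induction_on with
  | _ n ih =>
  intro hn x
  rcases n with _ | n
  · exact h0 x
  have hreg : ContDiff ℝ 2 (φ (n + 1)) := hφ.regular.2 n (by omega)
  have hper := hφ.periodic (n + 1) hn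
  have hb : ∀ j ≤ n, ∀ x, |φ j x| ≤ 1 := fun j hj => ih j (by omega) (by omega)
  have heq : ∀ x, l1Deriv α τ (fun k => φ k x) (n + 1) = γ * (ε ^ 2 * Δ (φ (n + 1)) x
      + φ n x - φ n x ^ 3 + S * (φ n x - φ (n + 1) x)) := by
    intro x
    rw [hφ.scheme n (by omega) x]
    simp only [Model.opG, Model.chemPot, Model.opL, Model.varE1, Model.opStab, deriv_doubleWell]
    ring
  refine abs_le.2 ⟨?_, allenCahn_step_le_one hα0 hα1 hτ hℓ hγ hS hreg hper hb heq x⟩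
  -- The scheme is odd in φ, so the upper bound for -φ is the lower bound for φ.
  have := allenCahn_step_le_one (φ := fun k x => -φ k x) (ε := ε) hα0 hα1 hτ hℓ hγ hS (n := n)
    hreg.neg (fun i x => by simp [hper i x]) (fun j hj x => by simpa using hb j hj x)
    (fun x => by
      have hl : Δ (fun x => -φ (n + 1) x) x = -Δ (φ (n + 1)) x := by
        have := congrFun (InnerProductSpace.laplacian_neg (f := φ (n + 1))) x
        exact this
      rw [l1Deriv_neg, heq x, hl]
      ring) x
  linarith

end MaximumPrinciple

/-! ### Inversion of the discrete L1 convolution -/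

section Inverse

variable {V : Type*} [AddCommGroup V] [Module ℝ V]

/-- The solution `ψ` of `∑_{j=1}^k b_{k-j} ψ_j = f_k`, `k ≥ 1`. -/
def l1Inverse (α τ : ℝ) (f : ℕ → V) (k : ℕ) : V :=
  (l1Coeff α τ 0)⁻¹ • (f k - ∑ j : Fin (k - 1), l1Coeff α τ (k - (j + 1)) • l1Inverse α τ f (j + 1))
termination_by k
decreasing_by omega

variable {α τ : ℝ}

theorem sum_Icc_one_succ {M : Type*} [AddCommMonoid M] (g : ℕ → M) (k : ℕ) :
    ∑ j ∈ Finset.Icc 1 (k + 1), g j = (∑ j : Fin k, g (j + 1)) + g (k + 1) := by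
  rw [Finset.sum_Icc_succ_top (by omega), Fin.sum_univ_eq_sum_range (fun j => g (j + 1)),
    Finset.range_eq_Ico, Finset.sum_Ico_add' g 0 k 1]
  rfl

theorem sum_l1Coeff_l1Inverse (hα1 : α < 1) (hτ : 0 < τ) (f : ℕ → V) {k : ℕ} (hk : 1 ≤ k) :
    ∑ j ∈ Finset.Icc 1 k, l1Coeff α τ (k - j) • l1Inverse α τ f j = f k := by
  obtain ⟨k, rfl⟩ := Nat.exists_eq_add_of_le' hk
  rw [sum_Icc_one_succ, Nat.sub_self, l1Inverse.eq_1 α τ f (k + 1), smul_smul,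
    mul_inv_cancel₀ (l1Coeff_pos hα1 hτ 0).ne', one_smul]
  exact add_sub_cancel _ _

/-- Forward substitution forms only finite linear combinations, so ψ inherits the regularity and
periodicity of μ. -/
theorem l1Inverse_mem (P : Submodule ℝ V) {f : ℕ → V} {N : ℕ}
    (hf : ∀ k, 1 ≤ k → k ≤ N → f k ∈ P) {k : ℕ} (h1 : 1 ≤ k) (hk : k ≤ N) :
    l1Inverse α τ f k ∈ P := by
  induction k using Nat.strong_induction_on with
  | _ k ih =>
  rw [l1Inverse]
  refine P.smul_mem _ (P.sub_mem (hf k h1 hk) (P.sum_mem fun j _ => P.smul_mem _ ?_))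
  have := j.2
  exact ih (j + 1) (by omega) (by omega) (by omega)

/-- The system is triangular with diagonal b_0 > 0, so the convolution can be cancelled. -/
theorem eq_of_sum_l1Coeff_eq (hα1 : α < 1) (hτ : 0 < τ) {f g : ℕ → ℝ} {N : ℕ}
    (h : ∀ k, 1 ≤ k → k ≤ N → ∑ j ∈ Finset.Icc 1 k, l1Coeff α τ (k - j) * f j
      = ∑ j ∈ Finset.Icc 1 k, l1Coeff α τ (k - j) * g j) {k : ℕ} (h1 : 1 ≤ k) (hk : k ≤ N) :
    f k = g k := by
  induction k using Nat.strong_induction_on with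
  | _ k ih =>
  have := h k h1 hk
  obtain ⟨k, rfl⟩ := Nat.exists_eq_add_of_le' h1
  rw [Finset.sum_Icc_succ_top h1, Finset.sum_Icc_succ_top h1, Finset.sum_congr rfl fun j hj => by
    rw [ih j (by have := Finset.mem_Icc.1 hj; omega) (Finset.mem_Icc.1 hj).1
      (by have := Finset.mem_Icc.1 hj; omega)]] at this
  exact mul_left_cancel₀ (l1Coeff_pos hα1 hτ _).ne' (add_left_cancel this)

end Inverse

/-! ### Dissipation of the weighted energy -/

section Dissipation

variable {d : ℕ} {ℓ : Fin d → ℝ} {α τ : ℝ}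

open MeasureTheory

theorem weightedEnergy_sub (E : ℕ → ℝ) {n : ℕ} (hn : 1 ≤ n) :
    weightedEnergy α τ E n = weightedEnergy α τ E (n - 1) + τ * weightedDeriv α τ E n := by
  obtain ⟨n, rfl⟩ := Nat.exists_eq_add_of_le' hn
  simp only [weightedEnergy, Nat.add_sub_cancel, Finset.sum_Icc_succ_top hn]
  ring

theorem weightedDeriv_nonpos (hα0 : 0 < α) (hα1 : α < 1) (hτ : 0 < τ) {E r : ℕ → ℝ} {n : ℕ}
    (hE : ∀ k, 1 ≤ k → k ≤ n → E k - E (k - 1) ≤ r k)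
    (hr : ∑ k ∈ Finset.Icc 1 n, ((k : ℝ) * τ) ^ α * l1Coeff α τ (n - k) * r k ≤ 0) :
    weightedDeriv α τ E n ≤ 0 := by
  have hΓ := Real.Gamma_pos_of_pos hα0
  refine mul_nonpos_of_nonneg_of_nonpos (by positivity) ?_
  refine nonpos_of_mul_nonpos_right (le_trans ?_ hr) hτ
  rw [Finset.mul_sum]
  refine Finset.sum_le_sum fun k hk => ?_
  obtain ⟨h1, h2⟩ := Finset.mem_Icc.1 hk
  have e : τ * (((k : ℝ) * τ) ^ α * l1Coeff α τ (n - k) * backwardDiff τ E k)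
      = ((k : ℝ) * τ) ^ α * l1Coeff α τ (n - k) * (E k - E (k - 1)) := by
    simp only [backwardDiff]; field_simp
  rw [e]
  exact mul_le_mul_of_nonneg_left (hE k h1 h2)
    (mul_nonneg (by positivity) (l1Coeff_pos hα1 hτ _).le)

/-- The dissipation of the `L²` gradient flows. -/
theorem weighted_dissipation_of_neg (hα0 : 0 < α) (hα1 : α < 1) (hτ : 0 < τ) {γ : ℝ} (hγ : 0 < γ)
    {φ μ : ℕ → EuclideanSpace ℝ (Fin d) → ℝ} {n : ℕ} (hφ : ∀ k ≤ n, Continuous (φ k))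
    (hμ : ∀ k, 1 ≤ k → k ≤ n → ∀ x, l1Deriv α τ (fun j => φ j x) k = γ * -μ k x) :
    ∑ k ∈ Finset.Icc 1 n, ((k : ℝ) * τ) ^ α * l1Coeff α τ (n - k) *
      ∫ x in cell ℓ, μ k x * (φ k x - φ (k - 1) x) ≤ 0 := by
  set f : ℕ → EuclideanSpace ℝ (Fin d) → ℝ := fun k x =>
    ((k : ℝ) * τ) ^ α * l1Coeff α τ (n - k) *
      (backwardDiff τ (fun j => φ j x) k * l1Deriv α τ (fun j => φ j x) k) with hf
  have hc : ∀ k ∈ Finset.Icc 1 n, Continuous (f k) := by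
    intro k hk
    obtain ⟨h1, h2⟩ := Finset.mem_Icc.1 hk
    have hb : ∀ j ≤ k, Continuous fun x => backwardDiff τ (fun i => φ i x) j := fun j hj =>
      ((hφ j (by omega)).sub (hφ (j - 1) (by omega))).div_const τ
    refine continuous_const.mul ((hb k le_rfl).mul ?_)
    exact continuous_finsetSum _ fun j hj =>
      continuous_const.mul (hb j (Finset.mem_Icc.1 hj).2)
  -- The scheme replaces μᵏ by -1/γ times the L1 derivative, and the increment is τ times the
  -- difference quotient.
  have hint : ∑ k ∈ Finset.Icc 1 n, ((k : ℝ) * τ) ^ α * l1Coeff α τ (n - k) *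
      ∫ x in cell ℓ, μ k x * (φ k x - φ (k - 1) x)
      = -(τ / γ) * ∫ x in cell ℓ, ∑ k ∈ Finset.Icc 1 n, f k x := by
    rw [integral_finsetSum _ fun k hk => (hc k hk).integrableOn_cell ℓ, Finset.mul_sum]
    refine Finset.sum_congr rfl fun k hk => ?_
    obtain ⟨h1, h2⟩ := Finset.mem_Icc.1 hk
    rw [← integral_const_mul, ← integral_const_mul]
    refine integral_congr_ae (Filter.Eventually.of_forall fun x => ?_)
    simp only [hf, hμ k h1 h2 x, backwardDiff]
    field_simp
  rw [hint]
  exact mul_nonpos_of_nonpos_of_nonneg (neg_nonpos.2 (by positivity))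
    (integral_nonneg fun x => l1Coeff_form_nonneg hα0 hα1 hτ n _)

/-- The twice continuously differentiable functions with given periods. -/
def periodicC2 (ℓ : Fin d → ℝ) : Submodule ℝ (EuclideanSpace ℝ (Fin d) → ℝ) where
  carrier := {u | ContDiff ℝ 2 u ∧ IsPeriodic ℓ u}
  add_mem' hu hv := ⟨hu.1.add hv.1, fun i x => by simp [hu.2 i x, hv.2 i x]⟩
  zero_mem' := ⟨contDiff_const, fun _ _ => rfl⟩
  smul_mem' c u hu := ⟨hu.1.const_smul c, fun i x => by simp [hu.2 i x]⟩

theorem gradient_sum_smul {ι : Type*} (s : Finset ι) (c : ι → ℝ)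
    {u : ι → EuclideanSpace ℝ (Fin d) → ℝ} (hu : ∀ i ∈ s, Differentiable ℝ (u i))
    (x : EuclideanSpace ℝ (Fin d)) :
    gradient (∑ i ∈ s, c i • u i) x = ∑ i ∈ s, c i • gradient (u i) x := by
  rw [gradient, fderiv_sum fun i hi => (hu i hi x).const_smul (c i), map_sum]
  refine Finset.sum_congr rfl fun i hi => ?_
  rw [fderiv_const_smul (hu i hi x)]
  simp [gradient]

theorem laplacian_sum_smul {ι : Type*} (s : Finset ι) (c : ι → ℝ)
    {u : ι → EuclideanSpace ℝ (Fin d) → ℝ} (hu : ∀ i ∈ s, ContDiff ℝ 2 (u i))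
    (x : EuclideanSpace ℝ (Fin d)) :
    Δ (∑ i ∈ s, c i • u i) x = ∑ i ∈ s, c i * Δ (u i) x := by
  classical
  induction s using Finset.induction_on with
  | empty =>
    rw [Finset.sum_empty, Finset.sum_empty]
    exact congrFun (InnerProductSpace.laplacian_const (c := (0 : ℝ))) x
  | insert i s hi ih =>
    have h1 := hu i (Finset.mem_insert_self i s)
    have h2 : ContDiff ℝ 2 (∑ i ∈ s, c i • u i) :=
      (show (∑ i ∈ s, c i • u i) = fun x => ∑ i ∈ s, c i • u i x by ext; simp) ▸
        ContDiff.sum fun j hj => (hu j (Finset.mem_insert_of_mem hj)).const_smul (c j)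
    rw [Finset.sum_insert hi, Finset.sum_insert hi,
      (show ContDiff ℝ 2 (c i • u i) from h1.const_smul (c i)).contDiffAt.laplacian_add h2.contDiffAt,
      InnerProductSpace.laplacian_smul _ h1.contDiffAt, smul_eq_mul,
      ih fun j hj => hu j (Finset.mem_insert_of_mem hj)]

/-- The dissipation of the `H⁻¹` gradient flow. -/
theorem weighted_dissipation_of_laplacian (hd : 0 < d) (hℓ : ∀ i, 0 < ℓ i) (hα0 : 0 < α)
    (hα1 : α < 1) (hτ : 0 < τ) {γ : ℝ} (hγ : 0 < γ)
    {φ μ : ℕ → EuclideanSpace ℝ (Fin d) → ℝ} {n : ℕ}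
    (hμ2 : ∀ k, 1 ≤ k → k ≤ n → μ k ∈ periodicC2 ℓ)
    (hμ : ∀ k, 1 ≤ k → k ≤ n → ∀ x, l1Deriv α τ (fun j => φ j x) k = γ * Δ (μ k) x) :
    ∑ k ∈ Finset.Icc 1 n, ((k : ℝ) * τ) ^ α * l1Coeff α τ (n - k) *
      ∫ x in cell ℓ, μ k x * (φ k x - φ (k - 1) x) ≤ 0 := by
  set ψ := l1Inverse α τ μ with hψ
  have hmem : ∀ k ∈ Finset.Icc 1 n, ψ k ∈ periodicC2 ℓ := fun k hk =>
    l1Inverse_mem _ hμ2 (Finset.mem_Icc.1 hk).1 (Finset.mem_Icc.1 hk).2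
  have hsub : ∀ {k j}, k ∈ Finset.Icc 1 n → j ∈ Finset.Icc 1 k → j ∈ Finset.Icc 1 n := by
    intro k j; simp only [Finset.mem_Icc]; omega
  have hsum : ∀ k ∈ Finset.Icc 1 n,
      μ k = ∑ j ∈ Finset.Icc 1 k, l1Coeff α τ (k - j) • ψ j := fun k hk =>
    (sum_l1Coeff_l1Inverse hα1 hτ μ (Finset.mem_Icc.1 hk).1).symm
  -- Both the difference quotients of φ and γ Δψ have L1 convolution γ Δμ, hence they agree.
  have hlap : ∀ k ∈ Finset.Icc 1 n, ∀ x,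
      φ k x - φ (k - 1) x = τ * γ * Δ (ψ k) x := by
    intro k hk x
    have := eq_of_sum_l1Coeff_eq hα1 hτ (f := backwardDiff τ fun j => φ j x)
      (g := fun j => γ * Δ (ψ j) x) (N := n) (fun k h1 h2 => by
        have hk := Finset.mem_Icc.2 ⟨h1, h2⟩
        refine (hμ k h1 h2 x).trans ?_
        rw [hsum k hk, laplacian_sum_smul _ _ (fun j hj => (hmem j (hsub hk hj)).1), Finset.mul_sum]
        exact Finset.sum_congr rfl fun j _ => by ring)
      (Finset.mem_Icc.1 hk).1 (Finset.mem_Icc.1 hk).2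
    simp only [backwardDiff] at this
    rw [div_eq_iff hτ.ne'] at this
    rw [this]; ring
  have hC1 : ∀ {u}, u ∈ periodicC2 ℓ → ContDiff ℝ 1 u := fun hu => hu.1.of_le one_le_two
  set f : ℕ → EuclideanSpace ℝ (Fin d) → ℝ := fun k x =>
    ((k : ℝ) * τ) ^ α * l1Coeff α τ (n - k) * inner ℝ (gradient (μ k) x) (gradient (ψ k) x) with hf
  have hc : ∀ k ∈ Finset.Icc 1 n, Continuous (f k) := by
    intro k hk
    obtain ⟨h1, h2⟩ := Finset.mem_Icc.1 hk
    exact continuous_const.mul ((continuous_gradient (hC1 (hμ2 k h1 h2))).inner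
      (continuous_gradient (hC1 (hmem k hk))))
  have hint : ∑ k ∈ Finset.Icc 1 n, ((k : ℝ) * τ) ^ α * l1Coeff α τ (n - k) *
      ∫ x in cell ℓ, μ k x * (φ k x - φ (k - 1) x)
      = -(τ * γ) * ∫ x in cell ℓ, ∑ k ∈ Finset.Icc 1 n, f k x := by
    rw [integral_finsetSum _ fun k hk => (hc k hk).integrableOn_cell ℓ, Finset.mul_sum]
    refine Finset.sum_congr rfl fun k hk => ?_
    obtain ⟨h1, h2⟩ := Finset.mem_Icc.1 hk
    have ibp := integral_mul_laplacian hd hℓ (hC1 (hμ2 k h1 h2)) (hmem k hk).1 (hμ2 k h1 h2).2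
      (hmem k hk).2
    have e : ∀ x, μ k x * (φ k x - φ (k - 1) x) = τ * γ * (μ k x * Δ (ψ k) x) := fun x => by
      rw [hlap k hk x]; ring
    simp_rw [e, hf]
    rw [integral_const_mul, integral_const_mul, ibp]
    ring
  rw [hint]
  refine mul_nonpos_of_nonpos_of_nonneg (neg_nonpos.2 (by positivity))
    (integral_nonneg fun x => ?_)
  -- Expanding ∇μᵏ as the convolution of ∇ψ gives one scalar L1 form per coordinate.
  have key : ∑ k ∈ Finset.Icc 1 n, f k x = ∑ i, ∑ k ∈ Finset.Icc 1 n,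
      ((k : ℝ) * τ) ^ α * l1Coeff α τ (n - k) * (gradient (ψ k) x i *
        ∑ j ∈ Finset.Icc 1 k, l1Coeff α τ (k - j) * gradient (ψ j) x i) := by
    rw [Finset.sum_comm]
    refine Finset.sum_congr rfl fun k hk => ?_
    simp only [hf]
    rw [PiLp.inner_apply, hsum k hk, gradient_sum_smul _ _ fun j hj =>
      (hmem j (hsub hk hj)).1.differentiable two_ne_zero, Finset.mul_sum]
    refine Finset.sum_congr rfl fun i _ => ?_
    simp
  simp only [Pi.zero_apply]
  rw [key]
  exact Finset.sum_nonneg fun i _ => l1Coeff_form_nonneg hα0 hα1 hτ n _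

namespace Model

theorem IsL1Solution.weightedDeriv_energy_nonpos {M : Model} {γ ε S : ℝ} {N : ℕ}
    {φ : ℕ → EuclideanSpace ℝ (Fin d) → ℝ} (hφ : M.IsL1Solution α τ γ ε S ℓ N φ)
    (hd : 0 < d) (hℓ : ∀ i, 0 < ℓ i) (hα0 : 0 < α) (hα1 : α < 1) (hγ : 0 < γ) (hτ : 0 < τ)
    (hM : M.Admissible S) (hφ0 : M = allenCahn → ∀ x, |φ 0 x| ≤ 1) {n : ℕ} (hn : n ≤ N) :
    weightedDeriv α τ (fun k => M.energy ε ℓ (φ k)) n ≤ 0 := by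
  have succ_of : ∀ {k}, 1 ≤ k → k ≤ n → ∃ m, k = m + 1 ∧ m < N := fun {k} h1 h2 =>
    ⟨k - 1, by omega, by omega⟩
  refine weightedDeriv_nonpos hα0 hα1 hτ
    (r := fun k => ∫ x in cell ℓ, M.chemPot ε S (φ (k - 1)) (φ k) x * (φ k x - φ (k - 1) x))
    ?_ ?_
  · intro k h1 h2
    obtain ⟨m, rfl, hm⟩ := succ_of h1 h2
    rw [Nat.add_sub_cancel]
    have hpu := hφ.periodic m (by omega)
    have hpv := hφ.periodic (m + 1) (by omega)
    match M, hM, hφ, hφ0 with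
    | allenCahn, hM, hφ, hφ0 =>
      have hv := hφ.regular.2
      have hu : ContDiff ℝ 1 (φ m) := by
        rcases m with _ | m
        · exact hφ.regular.1
        · exact (hv m (by omega)).of_le one_le_two
      have hb := allenCahn_abs_le_one hα0 hα1 hτ hℓ hγ hM hφ (hφ0 rfl)
      have hF : ContDiff ℝ 1 doubleWell := by unfold doubleWell; fun_prop
      refine ginzburgLandau_sub_le hd hℓ hF hu (hv m hm) hpu hpv fun x => ?_
      have h3 := doubleWell_sub_le (hb m (by omega) x) (hb (m + 1) (by omega) x)
      have h4 : 2 ≤ S := hM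
      nlinarith [sq_nonneg (φ (m + 1) x - φ m x)]
    | cahnHilliard F L, hM, hφ, _ =>
      have hv := hφ.regular.2
      have hu : ContDiff ℝ 1 (φ m) := by
        rcases m with _ | m
        · exact hφ.regular.1
        · exact (hv m (by omega)).1.of_le one_le_two
      obtain ⟨hF, -, hL, hS⟩ := hM
      refine ginzburgLandau_sub_le hd hℓ (hF.of_le one_le_two) hu (hv m hm).1 hpu hpv fun x => ?_
      have h3 := potential_sub_le hF hL (φ m x) (φ (m + 1) x)
      nlinarith [mul_le_mul_of_nonneg_right hS (sq_nonneg (φ (m + 1) x - φ m x))]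
    | mbeNoSlopeSelection, hM, hφ, _ =>
      have hv := hφ.regular.2
      have hu : ContDiff ℝ 2 (φ m) := by
        rcases m with _ | m
        · exact hφ.regular.1
        · exact (hv m (by omega)).of_le (by norm_num)
      exact mbe_energy_sub_le hd hℓ hM hu (hv m hm) hpu hpv
  · match M, hM, hφ, hφ0 with
    | allenCahn, _, hφ, _ =>
      refine weighted_dissipation_of_neg hα0 hα1 hτ hγ (fun k hk => ?_) fun k h1 h2 x => ?_
      · rcases k with _ | k
        · exact hφ.regular.1.continuous
        · exact (hφ.regular.2 k (by omega)).continuous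
      · obtain ⟨m, rfl, hm⟩ := succ_of h1 h2
        exact hφ.scheme m hm x
    | cahnHilliard F L, hM, hφ, _ =>
      refine weighted_dissipation_of_laplacian hd hℓ hα0 hα1 hτ hγ (fun k h1 h2 => ?_)
        fun k h1 h2 x => ?_
      · obtain ⟨m, rfl, hm⟩ := succ_of h1 h2
        have hpu := hφ.periodic m (by omega)
        have hpv := hφ.periodic (m + 1) (by omega)
        refine ⟨(hφ.regular.2 m hm).2, fun i x => ?_⟩
        simp only [chemPot, opL, varE1, opStab, Nat.add_sub_cancel, hpu i x, hpv i x,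
          periodic_laplacian (hφ.regular.2 m hm).1 (hpv i) x]
      · obtain ⟨m, rfl, hm⟩ := succ_of h1 h2
        exact hφ.scheme m hm x
    | mbeNoSlopeSelection, _, hφ, _ =>
      refine weighted_dissipation_of_neg hα0 hα1 hτ hγ (fun k hk => ?_) fun k h1 h2 x => ?_
      · rcases k with _ | k
        · exact hφ.regular.1.continuous
        · exact (hφ.regular.2 k (by omega)).continuous
      · obtain ⟨m, rfl, hm⟩ := succ_of h1 h2
        exact hφ.scheme m hm x

end Model

end Dissipation

end TimeFractionalPhaseField

end

theorem theorem2p2 {d : ℕ} (hd : 0 < d) (ℓ : Fin d → ℝ) (hℓ : ∀ i, 0 < ℓ i)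
    (α : ℝ) (hα0 : 0 < α) (hα1 : α < 1) (γ ε S : ℝ) (hγ : 0 < γ) (hε : 0 < ε)
    (T : ℝ) (hT : 0 < T) (N : ℕ) (hN : 0 < N)
    (M : TimeFractionalPhaseField.Model) (hM : M.Admissible S)
    (φ : ℕ → EuclideanSpace ℝ (Fin d) → ℝ)
    (hφ : M.IsL1Solution α (T / N) γ ε S ℓ N φ)
    (hφ0 : M = TimeFractionalPhaseField.Model.allenCahn → ∀ x, |φ 0 x| ≤ 1) :
    ∀ n : ℕ, 1 ≤ n → n ≤ N →
      TimeFractionalPhaseField.weightedEnergy α (T / N) (fun k => M.energy ε ℓ (φ k)) n ≤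
          TimeFractionalPhaseField.weightedEnergy α (T / N) (fun k => M.energy ε ℓ (φ k)) (n - 1) ∧
        TimeFractionalPhaseField.weightedDeriv α (T / N) (fun k => M.energy ε ℓ (φ k)) n ≤ 0 := by
  intro n h1 hn
  have hτ : 0 < T / N := div_pos hT (Nat.cast_pos.2 hN)
  have h := hφ.weightedDeriv_energy_nonpos hd hℓ hα0 hα1 hγ hτ hM hφ0 hn
  refine ⟨?_, h⟩
  rw [TimeFractionalPhaseField.weightedEnergy_sub _ h1]
  linarith [mul_nonpos_of_nonneg_of_nonpos hτ.le h]
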